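/- Let $\vec{Q}=(Q_1,Q_2,Q_3)$ be a flag matroid of rank $(1,2,3)$ on $[4]=\{1,2,3,4\}$, i.e. $Q_k$ is a matroid of rank $k$ on $[4]$ and, for $i\le j$, every flat of $Q_i$ is a flat of $Q_j$. Let $\mathrm{Fl}(4)\subset \mathbb{P}(\wedge^1\mathbb{C}^4)\times\mathbb{P}(\wedge^2\mathbb{C}^4)\times\mathbb{P}(\wedge^3\mathbb{C}^4)$ be the complete flag variety in its Plücker embedding, and let the stratum $\mathrm{Fl}(\vec{Q})$ be its scheme-theoretic intersection with $T(Q_1)\times T(Q_2)\times T(Q_3)$, where $T(Q_k)=\mathbb{G}_m^{Q_k}/\mathbb{G}_m$ is the locus in $\mathbb{P}(\wedge^k\mathbb{C}^4)$ on which exactly the Plücker coordinates indexed by the bases of $Q_k$ are nonzero. Equivalently, $\mathrm{Fl}(\vec{Q})$ is the affine $\mathbb{C}$-scheme whose coordinate ring is the ring of $\mathbb{G}_m^3$-invariants (the part of multidegree $0$) of $S^{-1}(B/J)$, where $B$ is the polynomial ring over $\mathbb{C}$ in the Plücker variables indexed by bases of $Q_1,Q_2,Q_3$, $S$ is the monoid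 generated by these variables, and $J=(I+\langle p_\lambda : \lambda \text{ not a basis}\rangle)\cap B$ with $I$ the multihomogeneous ideal of $\mathrm{Fl}(4)$. Then $\mathrm{Fl}(\vec{Q})$ is smooth over $\mathbb{C}$ and irreducible (in particular nonempty). Moreover, at least one of the following holds: (i) $\mathrm{Fl}(\vec{Q})$ is a product of smaller strata: there is a subset $\emptyset\ne\lambda\subsetneq[4]$ such that $\vec{Q}|\lambda$ and $\vec{Q}/\lambda$ (restriction and contraction of each $Q_k$) are flag matroids on $\lambda$ and $[4]\setminus\lambda$, possibly with repeated ranks or ranks equal to $0$ or to the size of the ground set, $Q_k=Q_k|\lambda\oplus Q_k/\lambda$ for every $k$, and $\mathrm{Fl}(\vec{Q})\cong\mathrm{Fl}(\vec{Q}|\lambda)\times_{\mathbb{C}}\mathrm{Fl}(\vec{Q}/\lambda)$ over $\mathbb{C}$, where these strata are defined in the same way in the flag varieties of $\mathbb{C}^{\lambda}$ and $\mathbb{C}^{[4]\setminus\lambda}$; (ii) $\mathrm{Fl}(\vec{Q})$ is isomorphic over $\mathbb{C}$ to an open subscheme of an algebraic torus $\mathbb{G}_m^d$ for some $d\ge 0$.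 -/

import Mathlib

/-! Flag matroids, the flag variety in its Plücker embedding, and flag matroid strata, over `ℂ`.

Ground sets are subsets `E` of an ordered type `α`, so that restrictions and contractions (whose
ground sets are smaller) are covered by the same definitions. Ranks may repeat, and may be `0`. -/

/-- `Q` is a flag matroid of rank `(r 0, …, r (s - 1))` on the ground set `E`: the `i`-th constituent
is a matroid of rank `r i` on `E`, and for `i ≤ j` the matroid `Q i` is a quotient of `Q j`, that is,
every flat of `Q i` is a flat of `Q j`. -/
structure IsFlagMatroid {α : Type} {s : ℕ} (E : Set α) (r : Fin s → ℕ) (Q : Fin s → Matroid α) :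
    Prop where
  ground_eq : ∀ i, (Q i).E = E
  eRank_eq : ∀ i, (Q i).eRank = (r i : ℕ∞)
  isFlat_of_le : ∀ i j, i ≤ j → ∀ F : Set α, (Q i).IsFlat F → (Q j).IsFlat F

/-- `p` is a vector of (homogeneous) Plücker coordinates of the `k`-dimensional subspace `F` of
`ℂ^ι`: up to a nonzero scalar, `p l` is the maximal minor with columns `l` of a matrix whose rows
form a basis of `F`. -/
def IsPluckerVector {ι : Type} [LinearOrder ι] {k : ℕ} (F : Submodule ℂ (ι → ℂ))
    (p : {l : Finset ι // l.card = k} → ℂ) : Prop :=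
  ∃ (b : Module.Basis (Fin k) ℂ F) (c : ℂ), c ≠ 0 ∧
    ∀ l, p l = c * Matrix.det
      (Matrix.of fun i j : Fin k => (b i : ι → ℂ) (l.1.orderEmbOfFin l.2 j))

/-- Indices of the Plücker coordinates `p_l` on `ℙ(⋀^{r 0} ℂ^E) × ⋯ × ℙ(⋀^{r (s-1)} ℂ^E)`. -/
abbrev PluckerIndex {α : Type} {s : ℕ} (E : Set α) (r : Fin s → ℕ) : Type :=
  (i : Fin s) × {l : Finset E // l.card = r i}

/-- The multi-cone over the flag variety `Fl(r, E)`: all tuples of Plücker vectors of flags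
`F 0 ⊆ F 1 ⊆ ⋯` of subspaces of `ℂ^E` with `dim (F i) = r i`. -/
def flagCone {α : Type} [LinearOrder α] {s : ℕ} (E : Set α) (r : Fin s → ℕ) :
    Set (PluckerIndex E r → ℂ) :=
  {p | ∃ F : Fin s → Submodule ℂ (E → ℂ), Monotone F ∧
    ∀ i, IsPluckerVector (F i) fun l => p ⟨i, l⟩}

/-- The multihomogeneous ideal of the flag variety `Fl(r, E)`. -/
noncomputable def flagIdeal {α : Type} [LinearOrder α] {s : ℕ} (E : Set α) (r : Fin s → ℕ) :
    Ideal (MvPolynomial (PluckerIndex E r) ℂ) :=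
  MvPolynomial.vanishingIdeal ℂ (flagCone E r)

/-- The Plücker index `x = (i, l)` is a basis of `Q`, that is, `l` is a basis of `Q i`. -/
def IsBaseIndex {α : Type} {s : ℕ} {E : Set α} {r : Fin s → ℕ} (Q : Fin s → Matroid α)
    (x : PluckerIndex E r) : Prop :=
  (Q x.1).IsBase (Subtype.val '' (x.2.1 : Set E))

/-- Indices `(i, l)` with `l` a basis of `Q i`. -/
abbrev BaseIndex {α : Type} {s : ℕ} (E : Set α) (r : Fin s → ℕ) (Q : Fin s → Matroid α) : Type :=
  {x : PluckerIndex E r // IsBaseIndex Q x}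

/-- `I_Q = (I_{r,E} + ⟨p_l : l not a basis of Q⟩) ∩ B_Q`, an ideal of
`B_Q = ℂ[p_l : l a basis of Q]`. -/
noncomputable def stratumIdeal {α : Type} [LinearOrder α] {s : ℕ} (E : Set α) (r : Fin s → ℕ)
    (Q : Fin s → Matroid α) : Ideal (MvPolynomial (BaseIndex E r Q) ℂ) :=
  (flagIdeal E r ⊔ Ideal.span (MvPolynomial.X '' {x | ¬ IsBaseIndex Q x})).comap
    (MvPolynomial.rename (R := ℂ) (Subtype.val : BaseIndex E r Q → PluckerIndex E r))

/-- The multiplicative monoid `S_Q ⊆ B_Q` generated by the variables. -/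
noncomputable def variableMonoid {α : Type} {s : ℕ} (E : Set α) (r : Fin s → ℕ) (Q : Fin s → Matroid α) :
    Submonoid (MvPolynomial (BaseIndex E r Q) ℂ) :=
  Submonoid.closure (Set.range MvPolynomial.X)

/-- The multidegree: `p_(i, l)` has degree the `i`-th unit vector. -/
def multidegree {α : Type} {s : ℕ} (E : Set α) (r : Fin s → ℕ) (Q : Fin s → Matroid α) :
    BaseIndex E r Q → (Fin s → ℕ) :=
  fun x => Pi.single x.1.1 1

/-- `R_Q = S_Q⁻¹ (B_Q / I_Q)`. -/
abbrev LaurentRing {α : Type} [LinearOrder α] {s : ℕ} (E : Set α) (r : Fin s → ℕ)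
    (Q : Fin s → Matroid α) : Type :=
  Localization ((variableMonoid E r Q).map (Ideal.Quotient.mk (stratumIdeal E r Q)))

/-- The natural map `B_Q → R_Q`. -/
noncomputable def toLaurentRing {α : Type} [LinearOrder α] {s : ℕ} (E : Set α) (r : Fin s → ℕ)
    (Q : Fin s → Matroid α) : MvPolynomial (BaseIndex E r Q) ℂ →ₐ[ℂ] LaurentRing E r Q :=
  (IsScalarTower.toAlgHom ℂ (MvPolynomial (BaseIndex E r Q) ℂ ⧸ stratumIdeal E r Q)
    (LaurentRing E r Q)).comp (Ideal.Quotient.mkₐ ℂ (stratumIdeal E r Q))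

/-- The coordinate ring of the stratum of `Q`: the subring of `R_Q` of invariants of the torus
`𝔾ₘ^s`, which scales the variables `p_(i, l)` by the `i`-th coordinate. The invariants are the
elements of multidegree `0`, that is, the fractions `a / m` with `m ∈ S_Q` a monomial and `a ∈ B_Q`
multihomogeneous of the same multidegree as `m`. -/
noncomputable def stratumRing {α : Type} [LinearOrder α] {s : ℕ} (E : Set α) (r : Fin s → ℕ)
    (Q : Fin s → Matroid α) : Subalgebra ℂ (LaurentRing E r Q) where
  carrier := {f | ∃ (d : Fin s → ℕ) (a m : MvPolynomial (BaseIndex E r Q) ℂ),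
    a.IsWeightedHomogeneous (multidegree E r Q) d ∧
    m.IsWeightedHomogeneous (multidegree E r Q) d ∧
    m ∈ variableMonoid E r Q ∧ f * toLaurentRing E r Q m = toLaurentRing E r Q a}
  mul_mem' := by
    rintro f g ⟨d, a, m, ha, hm, hmS, hf⟩ ⟨e, b, n, hb, hn, hnS, hg⟩
    refine ⟨d + e, a * b, m * n, ha.mul hb, hm.mul hn, mul_mem hmS hnS, ?_⟩
    rw [map_mul, map_mul, ← hf, ← hg]
    ring
  add_mem' := by
    rintro f g ⟨d, a, m, ha, hm, hmS, hf⟩ ⟨e, b, n, hb, hn, hnS, hg⟩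
    refine ⟨d + e, a * n + m * b, m * n, (ha.mul hn).add (hm.mul hb), hm.mul hn,
      mul_mem hmS hnS, ?_⟩
    rw [map_add, map_mul, map_mul, map_mul, ← hf, ← hg]
    ring
  algebraMap_mem' c := by
    refine ⟨0, MvPolynomial.C c, 1, MvPolynomial.isWeightedHomogeneous_C _ c,
      MvPolynomial.isWeightedHomogeneous_one _ _, one_mem _, ?_⟩
    rw [map_one, mul_one]
    exact ((toLaurentRing E r Q).commutes c).symm

open AlgebraicGeometry CategoryTheory

/-- The flag matroid stratum `Fl(Q)`, an affine scheme. -/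
noncomputable def flagStratum {α : Type} [LinearOrder α] {s : ℕ} (E : Set α) (r : Fin s → ℕ)
    (Q : Fin s → Matroid α) : Scheme.{0} :=
  Spec (CommRingCat.of (stratumRing E r Q))

/-- The structure morphism `Fl(Q) ⟶ Spec ℂ`. -/
noncomputable def flagStratumToSpec {α : Type} [LinearOrder α] {s : ℕ} (E : Set α)
    (r : Fin s → ℕ) (Q : Fin s → Matroid α) :
    flagStratum E r Q ⟶ Spec (CommRingCat.of ℂ) :=
  Spec.map (CommRingCat.ofHom (algebraMap ℂ (stratumRing E r Q)))

/-- The torus `𝔾ₘ^d` over `ℂ`: the spectrum of the ring of Laurent polynomials in `d` variables. -/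
noncomputable def algTorus (d : ℕ) : Scheme.{0} :=
  Spec (CommRingCat.of (AddMonoidAlgebra ℂ (Fin d → ℤ)))

/-- The structure morphism `𝔾ₘ^d ⟶ Spec ℂ`. -/
noncomputable def algTorusToSpec (d : ℕ) : algTorus d ⟶ Spec (CommRingCat.of ℂ) :=
  Spec.map (CommRingCat.ofHom (algebraMap ℂ (AddMonoidAlgebra ℂ (Fin d → ℤ))))

/-- `Fl(Q)` is a product of smaller strata: for a nonempty proper subset `L` of the ground set `E`,
`Q` is the direct sum of the restriction `Q | L` and the contraction `Q / L`, these are flag matroids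
on `L` and on `E \ L`, and `Fl(Q) ≅ Fl(Q | L) × Fl(Q / L)` over `ℂ`. -/
def IsProductOfSmallerStrata {α : Type} [LinearOrder α] {s : ℕ} (E : Set α) (r : Fin s → ℕ)
    (Q : Fin s → Matroid α) : Prop :=
  ∃ (L : Set α) (r₁ r₂ : Fin s → ℕ), L.Nonempty ∧ L ⊂ E ∧
    IsFlagMatroid L r₁ (fun i => (Q i).restrict L) ∧
    IsFlagMatroid (E \ L) r₂ (fun i => (Q i).contract L) ∧
    (∀ i, ∃ h, Q i = ((Q i).restrict L).disjointSum ((Q i).contract L) h) ∧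
    ∃ e : flagStratum E r Q ≅
        Limits.pullback (flagStratumToSpec L r₁ fun i => (Q i).restrict L)
          (flagStratumToSpec (E \ L) r₂ fun i => (Q i).contract L),
      e.hom ≫ Limits.pullback.fst _ _ ≫ flagStratumToSpec L r₁ (fun i => (Q i).restrict L) =
        flagStratumToSpec E r Q

/-- `Fl(Q)` is isomorphic, over `ℂ`, to an open subvariety of a torus. -/
def IsOpenInTorus {α : Type} [LinearOrder α] {s : ℕ} (E : Set α) (r : Fin s → ℕ)
    (Q : Fin s → Matroid α) : Prop :=
  ∃ (d : ℕ) (f : flagStratum E r Q ⟶ algTorus d),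
    IsOpenImmersion f ∧ f ≫ algTorusToSpec d = flagStratumToSpec E r Q

/-! The second alternative always holds: every stratum is a principal open subset of a torus. More
precisely, the stratum ring is a localization `ℂ[t][1/f]` of a polynomial ring at a nonzero `f`
divisible by every variable. Smoothness, irreducibility (the ring is a domain) and the open
immersion into a torus all follow from this.

The parameters come from one normal form. The matroid `Q 1` provides a basis `{i, r}`, and the line
is written as the row space of a 2×4 matrix whose columns `i`, `r` are standard basis vectors. The
non-bases of `Q 1` say which columns are zero or parallel, so the free data are a magnitude for each
remaining nonzero column and a slope for each parallel class other than those of `i` and `r`. The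
point, scaled to have `i`-th coordinate 1, is the first row plus a multiple of the second. The plane
is a linear form vanishing on the line. This imposes two independent linear conditions, which
determine its coefficients at a basis `{d, e}` of `Q 1` from the others, one of which is scaled to
1.

The prescribed support must be compatible with this: a dependent coordinate has to vanish
identically in the parameters when it is not a basis, and must be a nonzero polynomial when it is.
With `i, r, d, e` chosen suitably, this is what the quotient conditions between `Q 0`, `Q 1`, `Q 2`
give (`nonempty_flagChart`, from `exists_line_chart`, `exists_plane_chart` and
`PlaneBase.exists_lineBase`). Then `f` is the product of the parameters and of the required nonzero
coordinates or their numerators, and `denom_ne_zero` tests each factor at an explicit point.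

No generators of the flag ideal are needed. The three-term and incidence relations hold on all
flags, hence in the stratum ring, and suffice to express every coordinate through the parameters
(`IsNormalized.mem_of_isBaseIndex`). Conversely, each parameter point with `f ≠ 0` is realized by an
actual flag (`FlagChart.exists_algHom`), so the parameters satisfy no algebraic relation. -/

/-! ### Localizations of polynomial rings, and open subsets of tori. -/

/-- An algebra homomorphism which inverts `f`, is injective, and through which every element is a
fraction with denominator a power of `f`, is the localization away from `f`. -/
theorem isLocalizationAway_of_injective {R S : Type*} [CommRing R] [CommRing S] [Algebra R S]
    {f : R} (hf : IsUnit (algebraMap R S f)) (hinj : Function.Injective (algebraMap R S))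
    (hsurj : ∀ r : S, ∃ (n : ℕ) (g : R), r * algebraMap R S f ^ n = algebraMap R S g) :
    IsLocalization.Away f S where
  map_units := by
    rintro ⟨_, n, rfl⟩
    simpa using hf.pow n
  surj r := by
    obtain ⟨n, g, h⟩ := hsurj r
    exact ⟨(g, ⟨f ^ n, n, rfl⟩), by simpa using h⟩
  exists_of_eq h := ⟨1, by rw [hinj h]⟩

section Criterion

variable {τ S : Type} [CommRing S] [Algebra ℂ S] {u : τ → S} {f : MvPolynomial τ ℂ}

/-- If every point of the principal open set `f ≠ 0` of affine space lifts to a `ℂ`-point of `S`,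
then the coordinates are algebraically independent. -/
theorem aeval_injective_of_points (hf0 : f ≠ 0)
    (hpt : ∀ t : τ → ℂ, MvPolynomial.eval t f ≠ 0 → ∃ ev : S →ₐ[ℂ] ℂ, ∀ s, ev (u s) = t s) :
    Function.Injective (MvPolynomial.aeval (R := ℂ) u) := by
  rw [injective_iff_map_eq_zero]
  intro g hg
  -- The factor `f` takes care of the points that do not lift; elsewhere `g` vanishes because its
  -- image in `S` does.
  have h : f * g = 0 := by
    refine MvPolynomial.funext fun t => ?_
    rw [map_mul, map_zero, mul_eq_zero]
    by_cases ht : MvPolynomial.eval t f = 0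
    · exact Or.inl ht
    · obtain ⟨ev, hev⟩ := hpt t ht
      right
      have h1 : ev (MvPolynomial.aeval u g) = MvPolynomial.aeval (fun s => ev (u s)) g := by
        rw [MvPolynomial.comp_aeval_apply]
      rw [hg, map_zero] at h1
      simp only [hev] at h1
      rw [h1, MvPolynomial.aeval_eq_eval]
  exact (mul_eq_zero.mp h).resolve_left hf0

theorem isDomain_of_aeval (hf0 : f ≠ 0) (hunit : IsUnit (MvPolynomial.aeval u f))
    (hinj : Function.Injective (MvPolynomial.aeval (R := ℂ) u))
    (hsurj : ∀ r : S, ∃ (n : ℕ) (g : MvPolynomial τ ℂ),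
      r * MvPolynomial.aeval u f ^ n = MvPolynomial.aeval u g) : IsDomain S := by
  let : Algebra (MvPolynomial τ ℂ) S := (MvPolynomial.aeval (R := ℂ) u).toRingHom.toAlgebra
  have : IsLocalization.Away f S := isLocalizationAway_of_injective hunit hinj hsurj
  exact IsLocalization.isDomain_of_le_nonZeroDivisors (M := Submonoid.powers f) S
    (powers_le_nonZeroDivisors_of_noZeroDivisors hf0)

variable [Fintype τ]

theorem smooth_of_aeval (hunit : IsUnit (MvPolynomial.aeval u f))
    (hinj : Function.Injective (MvPolynomial.aeval (R := ℂ) u))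
    (hsurj : ∀ r : S, ∃ (n : ℕ) (g : MvPolynomial τ ℂ),
      r * MvPolynomial.aeval u f ^ n = MvPolynomial.aeval u g) :
    AlgebraicGeometry.Smooth (Spec.map (CommRingCat.ofHom (algebraMap ℂ S))) := by
  rw [HasRingHomProperty.Spec_iff (P := @AlgebraicGeometry.Smooth)]
  change (algebraMap ℂ S).Smooth
  rw [RingHom.smooth_algebraMap]
  let : Algebra (MvPolynomial τ ℂ) S := (MvPolynomial.aeval (R := ℂ) u).toRingHom.toAlgebra
  have : IsScalarTower ℂ (MvPolynomial τ ℂ) S :=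
    IsScalarTower.of_algebraMap_eq fun c => ((MvPolynomial.aeval (R := ℂ) u).commutes c).symm
  have : IsLocalization.Away f S := isLocalizationAway_of_injective hunit hinj hsurj
  have : Algebra.Smooth (MvPolynomial τ ℂ) S := Algebra.Smooth.of_isLocalization_Away f
  have : Algebra.Smooth ℂ (MvPolynomial τ ℂ) := { 
    formallySmooth := inferInstance, finitePresentation := inferInstance }
  exact Algebra.Smooth.comp ℂ (MvPolynomial τ ℂ) S

/-- The homomorphism from Laurent polynomials given by a family of units. -/
noncomputable def laurentLift (v : τ → Sˣ) : AddMonoidAlgebra ℂ (τ → ℤ) →ₐ[ℂ] S :=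
  AddMonoidAlgebra.lift ℂ S (τ → ℤ)
    { toFun := fun z => ((∏ s, v s ^ (z.toAdd s) : Sˣ) : S)
      map_one' := by simp
      map_mul' := fun x y => by simp [zpow_add, Finset.prod_mul_distrib] }

/-- Polynomials as Laurent polynomials. -/
noncomputable def polyToLaurent (τ : Type) : MvPolynomial τ ℂ →ₐ[ℂ] AddMonoidAlgebra ℂ (τ → ℤ) := by
  classical
  exact MvPolynomial.aeval fun s => AddMonoidAlgebra.single (Pi.single s 1) 1

theorem laurentLift_single (v : τ → Sˣ) (z : τ → ℤ) (c : ℂ) :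
    laurentLift v (AddMonoidAlgebra.single z c) = c • ((∏ s, v s ^ (z s) : Sˣ) : S) := by
  rw [laurentLift, AddMonoidAlgebra.lift_single]
  rfl

theorem laurentLift_polyToLaurent (v : τ → Sˣ) (g : MvPolynomial τ ℂ) :
    laurentLift v (polyToLaurent τ g) = MvPolynomial.aeval (fun s => (v s : S)) g := by
  classical
  rw [polyToLaurent, MvPolynomial.comp_aeval_apply]
  congr 2
  ext s
  rw [laurentLift_single, one_smul, Finset.prod_eq_single s]
  · simp
  · intro t _ hts
    simp [hts]
  · simp

theorem polyToLaurent_monomial (k : τ →₀ ℕ) :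
    polyToLaurent τ (MvPolynomial.monomial k 1) =
      AddMonoidAlgebra.single (fun s => (k s : ℤ)) 1 := by
  classical
  rw [polyToLaurent, MvPolynomial.aeval_monomial, map_one, one_mul, Finsupp.prod_fintype _ _ (by simp)]
  simp only [AddMonoidAlgebra.single_pow, one_pow]
  have h : ∀ T : Finset τ, ∏ s ∈ T, AddMonoidAlgebra.single (k s • (Pi.single s 1 : τ → ℤ)) (1 : ℂ)
      = AddMonoidAlgebra.single (∑ s ∈ T, k s • (Pi.single s 1 : τ → ℤ)) 1 := by
    intro T
    induction T using Finset.induction_on with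
    | empty => simp [AddMonoidAlgebra.one_def]
    | insert a T ha ih =>
      rw [Finset.prod_insert ha, Finset.sum_insert ha, ih, AddMonoidAlgebra.single_mul_single, one_mul]
  rw [h]
  congr 1
  ext t
  simp [Finset.sum_apply, Pi.single_apply]

theorem exists_mul_single_eq_polyToLaurent (z : AddMonoidAlgebra ℂ (τ → ℤ)) :
    ∃ (k : τ →₀ ℕ) (g : MvPolynomial τ ℂ),
      z * polyToLaurent τ (MvPolynomial.monomial k 1) = polyToLaurent τ g := by
  induction z using AddMonoidAlgebra.induction_on with
  | of m =>
    refine ⟨Finsupp.equivFunOnFinite.symm fun s => (- m s).toNat,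
      MvPolynomial.monomial (Finsupp.equivFunOnFinite.symm fun s => (m s).toNat) 1, ?_⟩
    rw [polyToLaurent_monomial, polyToLaurent_monomial, AddMonoidAlgebra.of_apply,
      AddMonoidAlgebra.single_mul_single, one_mul]
    congr 1
    ext s
    simp
    omega
  | add x y hx hy =>
    obtain ⟨k, g, h⟩ := hx
    obtain ⟨l, g', h'⟩ := hy
    refine ⟨k + l, g * MvPolynomial.monomial l 1 + g' * MvPolynomial.monomial k 1, ?_⟩
    have : (MvPolynomial.monomial (k + l) (1 : ℂ)) = MvPolynomial.monomial k 1 *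
      MvPolynomial.monomial l 1 := by simp [MvPolynomial.monomial_mul]
    rw [this, map_mul, map_add, map_mul, map_mul, ← h, ← h']
    ring
  | smul r x hx =>
    obtain ⟨k, g, h⟩ := hx
    exact ⟨k, r • g, by rw [smul_mul_assoc, h, map_smul]⟩

theorem isOpenImmersion_laurentLift (v : τ → Sˣ)
    (hunit : IsUnit (MvPolynomial.aeval (fun s => (v s : S)) f))
    (hinj : Function.Injective (MvPolynomial.aeval (R := ℂ) fun s => (v s : S)))
    (hsurj : ∀ r : S, ∃ (n : ℕ) (g : MvPolynomial τ ℂ),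
      r * MvPolynomial.aeval (fun s => (v s : S)) f ^ n = MvPolynomial.aeval (fun s => (v s : S)) g) :
    IsOpenImmersion (Spec.map (CommRingCat.ofHom (laurentLift v).toRingHom)) := by
  let : Algebra (AddMonoidAlgebra ℂ (τ → ℤ)) S := (laurentLift v).toRingHom.toAlgebra
  have key : ∀ z, algebraMap (AddMonoidAlgebra ℂ (τ → ℤ)) S z = laurentLift v z := fun _ => rfl
  have : IsLocalization.Away (polyToLaurent τ f) S := by
    refine isLocalizationAway_of_injective ?_ ?_ ?_
    · rwa [key, laurentLift_polyToLaurent]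
    · rw [injective_iff_map_eq_zero]
      intro z hz
      rw [key] at hz
      -- A monomial multiple of `z` is a polynomial, for which injectivity is known; the monomial is
      -- then cancelled by its inverse.
      obtain ⟨k, g, h⟩ := exists_mul_single_eq_polyToLaurent z
      have h1 := congrArg (laurentLift v) h
      rw [map_mul, hz, zero_mul, laurentLift_polyToLaurent] at h1
      have hg : g = 0 := (injective_iff_map_eq_zero _).mp hinj g h1.symm
      rw [hg, map_zero, polyToLaurent_monomial] at h
      have h2 := congrArg (· * AddMonoidAlgebra.single (fun s => -(k s : ℤ)) (1 : ℂ)) h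
      simp only [zero_mul, mul_assoc, AddMonoidAlgebra.single_mul_single, one_mul] at h2
      have h3 : ((fun s => (k s : ℤ)) + fun s => -(k s : ℤ)) = (0 : τ → ℤ) := by
        ext s; simp
      rwa [h3, ← AddMonoidAlgebra.one_def, mul_one] at h2
    · intro r
      obtain ⟨n, g, h⟩ := hsurj r
      refine ⟨n, polyToLaurent τ g, ?_⟩
      rw [key, key, laurentLift_polyToLaurent, laurentLift_polyToLaurent, h]
  exact IsOpenImmersion.of_isLocalization (polyToLaurent τ f)

/-- A principal open subset of a torus. -/
theorem exists_isOpenImmersion_algTorus (hX : ∀ s, MvPolynomial.X s ∣ f)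
    (hunit : IsUnit (MvPolynomial.aeval u f))
    (hinj : Function.Injective (MvPolynomial.aeval (R := ℂ) u))
    (hsurj : ∀ r : S, ∃ (n : ℕ) (g : MvPolynomial τ ℂ),
      r * MvPolynomial.aeval u f ^ n = MvPolynomial.aeval u g) :
    ∃ (d : ℕ) (F : Spec (CommRingCat.of S) ⟶ algTorus d),
      IsOpenImmersion F ∧ F ≫ algTorusToSpec d =
        Spec.map (CommRingCat.ofHom (algebraMap ℂ S)) := by
  let e := Fintype.equivFin τ
  -- Divisibility of `f` by the variables makes each parameter a unit, so the map extends to Laurent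
  -- polynomials.
  have hu : ∀ s, IsUnit (u s) := fun s => by
    have h := map_dvd (MvPolynomial.aeval (R := ℂ) u) (hX s)
    rw [MvPolynomial.aeval_X] at h
    exact isUnit_of_dvd_unit h hunit
  choose v hv using hu
  have hcomp : ∀ g : MvPolynomial τ ℂ, MvPolynomial.aeval (fun s => ((v (e.symm s) : Sˣ) : S))
      (MvPolynomial.rename e g) = MvPolynomial.aeval u g := fun g => by
    rw [MvPolynomial.aeval_rename]
    congr 2
    ext s
    simp [hv]
  have hcomp' : ∀ g : MvPolynomial (Fin (Fintype.card τ)) ℂ,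
      MvPolynomial.aeval (fun s => ((v (e.symm s) : Sˣ) : S)) g =
        MvPolynomial.aeval u (MvPolynomial.rename e.symm g) := fun g => by
    rw [← hcomp, MvPolynomial.rename_rename]
    simp
  have hopen := isOpenImmersion_laurentLift (f := MvPolynomial.rename e f) (fun s => v (e.symm s))
    (by rwa [hcomp])
    (fun g g' h => by
      rw [hcomp', hcomp'] at h
      exact MvPolynomial.rename_injective _ e.symm.injective (hinj h))
    (fun r => by
      obtain ⟨n, g, h⟩ := hsurj r
      exact ⟨n, MvPolynomial.rename e g, by rw [hcomp, hcomp, h]⟩)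
  refine ⟨_, _, hopen, ?_⟩
  refine (Spec.map_comp _ _).symm.trans ?_
  rw [← CommRingCat.ofHom_comp]
  congr 2
  exact (laurentLift fun s => v (e.symm s)).comp_algebraMap

end Criterion

/-! ### Plücker coordinates on the stratum and their normalization. -/

section Coordinates

variable {α : Type} [LinearOrder α] {s : ℕ} {E : Set α} {r : Fin s → ℕ} {Q : Fin s → Matroid α}

open Classical in
/-- The Plücker coordinates as elements of `R_Q`. -/
noncomputable def laurentCoord (Q : Fin s → Matroid α) (x : PluckerIndex E r) : LaurentRing E r Q :=
  if h : IsBaseIndex Q x then toLaurentRing E r Q (MvPolynomial.X ⟨x, h⟩) else 0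

theorem laurentCoord_of_isBaseIndex {x : PluckerIndex E r} (h : IsBaseIndex Q x) :
    laurentCoord Q x = toLaurentRing E r Q (MvPolynomial.X ⟨x, h⟩) := dif_pos h

theorem laurentCoord_of_not {x : PluckerIndex E r} (h : ¬ IsBaseIndex Q x) :
    laurentCoord Q x = 0 := dif_neg h

theorem toLaurentRing_eq_zero {g : MvPolynomial (BaseIndex E r Q) ℂ}
    (hg : g ∈ stratumIdeal E r Q) : toLaurentRing E r Q g = 0 := by
  have : Ideal.Quotient.mk (stratumIdeal E r Q) g = 0 := Ideal.Quotient.eq_zero_iff_mem.mpr hg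
  change algebraMap (MvPolynomial (BaseIndex E r Q) ℂ ⧸ stratumIdeal E r Q) (LaurentRing E r Q)
    (Ideal.Quotient.mk _ g) = 0
  rw [this, map_zero]

theorem isUnit_toLaurentRing {m : MvPolynomial (BaseIndex E r Q) ℂ}
    (hm : m ∈ variableMonoid E r Q) : IsUnit (toLaurentRing E r Q m) :=
  IsLocalization.map_units (LaurentRing E r Q)
    (⟨_, Submonoid.mem_map_of_mem _ hm⟩ :
      (variableMonoid E r Q).map (Ideal.Quotient.mk (stratumIdeal E r Q)))

omit [LinearOrder α] in
theorem X_mem_variableMonoid (x : BaseIndex E r Q) :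
    (MvPolynomial.X x : MvPolynomial (BaseIndex E r Q) ℂ) ∈ variableMonoid E r Q :=
  Submonoid.subset_closure ⟨x, rfl⟩

theorem isUnit_laurentCoord {x : PluckerIndex E r} (h : IsBaseIndex Q x) :
    IsUnit (laurentCoord Q x) := by
  rw [laurentCoord_of_isBaseIndex h]
  exact isUnit_toLaurentRing (X_mem_variableMonoid _)

/-- The coordinates of `R_Q` satisfy the equations of the flag variety. -/
theorem aeval_laurentCoord {g : MvPolynomial (PluckerIndex E r) ℂ} (hg : g ∈ flagIdeal E r) :
    MvPolynomial.aeval (laurentCoord Q) g = 0 := by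
  classical
  let ρ : MvPolynomial (PluckerIndex E r) ℂ →ₐ[ℂ] MvPolynomial (BaseIndex E r Q) ℂ :=
    MvPolynomial.aeval fun x => if h : IsBaseIndex Q x then MvPolynomial.X ⟨x, h⟩ else 0
  have h1 : ∀ g, MvPolynomial.aeval (laurentCoord Q) g = toLaurentRing E r Q (ρ g) := fun g => by
    rw [MvPolynomial.comp_aeval_apply]
    congr 2
    ext x
    by_cases h : IsBaseIndex Q x
    · rw [laurentCoord_of_isBaseIndex h, dif_pos h]
    · rw [laurentCoord_of_not h, dif_neg h, map_zero]
  rw [h1]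
  refine toLaurentRing_eq_zero ?_
  let J : Ideal (MvPolynomial (PluckerIndex E r) ℂ) :=
    Ideal.span (MvPolynomial.X '' {x | ¬ IsBaseIndex Q x})
  -- Killing the non-basis variables does not change a polynomial modulo the ideal `J` which they
  -- generate.
  have h2 : (Ideal.Quotient.mkₐ ℂ J).comp ((MvPolynomial.rename Subtype.val).comp ρ) =
      Ideal.Quotient.mkₐ ℂ J := by
    refine MvPolynomial.algHom_ext fun x => ?_
    by_cases h : IsBaseIndex Q x
    · simp [ρ, h]
    · have : Ideal.Quotient.mk J (MvPolynomial.X x) = 0 :=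
        Ideal.Quotient.eq_zero_iff_mem.mpr (Ideal.subset_span ⟨x, h, rfl⟩)
      simp [ρ, h, this]
  have h3 : MvPolynomial.rename Subtype.val (ρ g) - g ∈ J :=
    Ideal.Quotient.eq.mp (DFunLike.congr_fun h2 g)
  rw [stratumIdeal, Ideal.mem_comap]
  have := Ideal.add_mem _ (Ideal.mem_sup_right (S := flagIdeal E r) h3) (Ideal.mem_sup_left hg)
  rwa [sub_add_cancel] at this

/-- A point of the multi-cone whose support is the set of bases is a `ℂ`-point of `R_Q`. -/
theorem exists_algHom_of_mem_flagCone {p : PluckerIndex E r → ℂ} (hp : p ∈ flagCone E r)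
    (hsupp : ∀ x, p x ≠ 0 ↔ IsBaseIndex Q x) :
    ∃ ev : LaurentRing E r Q →ₐ[ℂ] ℂ, ∀ x, ev (laurentCoord Q x) = p x := by
  let φ : MvPolynomial (BaseIndex E r Q) ℂ →ₐ[ℂ] ℂ := MvPolynomial.aeval fun x => p x.1
  have hker : ∀ g ∈ stratumIdeal E r Q, φ g = 0 := by
    intro g hg
    have h1 : φ g = MvPolynomial.aeval p (MvPolynomial.rename Subtype.val g) := by
      rw [MvPolynomial.aeval_rename]
      rfl
    rw [h1]
    have h2 : flagIdeal E r ⊔ Ideal.span (MvPolynomial.X '' {x | ¬ IsBaseIndex Q x}) ≤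
        RingHom.ker (MvPolynomial.aeval (R := ℂ) p) := by
      refine sup_le (fun g hg => ?_) (Ideal.span_le.mpr ?_)
      · exact (MvPolynomial.mem_vanishingIdeal_iff.mp hg) p hp
      · rintro _ ⟨x, hx, rfl⟩
        have : p x = 0 := not_not.mp fun h => hx ((hsupp x).mp h)
        simpa [RingHom.mem_ker] using this
    exact h2 hg
  let ψ : (MvPolynomial (BaseIndex E r Q) ℂ ⧸ stratumIdeal E r Q) →ₐ[ℂ] ℂ :=
    Ideal.Quotient.liftₐ _ φ hker
  have hunit : ∀ y : (variableMonoid E r Q).map (Ideal.Quotient.mk (stratumIdeal E r Q)),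
      IsUnit (ψ y) := by
    rintro ⟨_, m, hm, rfl⟩
    change IsUnit (φ m)
    refine Submonoid.closure_induction (motive := fun m _ => IsUnit (φ m)) ?_ ?_ ?_ hm
    · rintro _ ⟨x, rfl⟩
      simpa [φ] using (hsupp x.1).mpr x.2
    · simp
    · intro a b _ _ ha hb
      rw [map_mul]
      exact ha.mul hb
  let ev : LaurentRing E r Q →ₐ[ℂ] ℂ := IsLocalization.liftAlgHom (f := ψ) hunit
  refine ⟨ev, fun x => ?_⟩
  by_cases h : IsBaseIndex Q x
  · rw [laurentCoord_of_isBaseIndex h]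
    have : ev (algebraMap _ _ (Ideal.Quotient.mk (stratumIdeal E r Q) (MvPolynomial.X ⟨x, h⟩))) =
        ψ (Ideal.Quotient.mk (stratumIdeal E r Q) (MvPolynomial.X ⟨x, h⟩)) := IsLocalization.lift_eq _ _
    refine this.trans ?_
    change φ (MvPolynomial.X _) = _
    simp [φ]
  · rw [laurentCoord_of_not h, map_zero]
    exact (not_not.mp fun h' => h ((hsupp x).mp h')).symm

/-- A choice, for each constituent, of a nonzero multiple of a coordinate which is to be
normalized to `1`. -/
structure Normalizer (E : Set α) (r : Fin s → ℕ) (Q : Fin s → Matroid α) where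
  index : Fin s → PluckerIndex E r
  index_fst : ∀ i, (index i).1 = i
  isBaseIndex : ∀ i, IsBaseIndex Q (index i)
  scalar : Fin s → ℂ
  scalar_ne_zero : ∀ i, scalar i ≠ 0

namespace Normalizer

variable (n : Normalizer E r Q)

/-- The normalizing unit. -/
noncomputable def unit (i : Fin s) : (LaurentRing E r Q)ˣ :=
  (isUnit_laurentCoord (n.isBaseIndex i)).unit *
    Units.map (algebraMap ℂ (LaurentRing E r Q)).toMonoidHom (Units.mk0 _ (n.scalar_ne_zero i))

theorem coe_unit (i : Fin s) : (n.unit i : LaurentRing E r Q) =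
    n.scalar i • laurentCoord Q (n.index i) := by
  rw [unit, Algebra.smul_def, mul_comm]
  rfl

/-- The normalized Plücker coordinates. -/
noncomputable def coord (x : PluckerIndex E r) : stratumRing E r Q :=
  ⟨laurentCoord Q x * ((n.unit x.1)⁻¹ : (LaurentRing E r Q)ˣ), by
    by_cases hx : IsBaseIndex Q x
    · refine ⟨Pi.single x.1 1, MvPolynomial.C (n.scalar x.1)⁻¹ * MvPolynomial.X ⟨x, hx⟩,
        MvPolynomial.X ⟨_, n.isBaseIndex x.1⟩, ?_, ?_, X_mem_variableMonoid _, ?_⟩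
      · simpa [multidegree] using (MvPolynomial.isWeightedHomogeneous_C (multidegree E r Q) (n.scalar x.1)⁻¹).mul
          (MvPolynomial.isWeightedHomogeneous_X ℂ (multidegree E r Q) ⟨x, hx⟩)
      · have := MvPolynomial.isWeightedHomogeneous_X ℂ (multidegree E r Q)
          ⟨_, n.isBaseIndex x.1⟩
        rwa [multidegree, n.index_fst] at this
      · rw [map_mul, ← laurentCoord_of_isBaseIndex, ← laurentCoord_of_isBaseIndex, mul_assoc,
          mul_comm, ← MvPolynomial.algebraMap_eq, AlgHom.commutes]
        congr 1
        rw [Units.inv_mul_eq_iff_eq_mul, coe_unit, Algebra.smul_def, mul_right_comm, ← map_mul,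
          mul_inv_cancel₀ (n.scalar_ne_zero _), map_one, one_mul]
    · rw [laurentCoord_of_not hx, zero_mul]
      exact zero_mem (stratumRing E r Q)⟩

theorem coe_coord (x : PluckerIndex E r) : (n.coord x : LaurentRing E r Q) =
    laurentCoord Q x * ((n.unit x.1)⁻¹ : (LaurentRing E r Q)ˣ) := rfl

theorem coord_of_not {x : PluckerIndex E r} (h : ¬ IsBaseIndex Q x) : n.coord x = 0 := by
  apply Subtype.ext
  rw [coe_coord, laurentCoord_of_not h, zero_mul]
  rfl

/-- The inverse is again a fraction of two variables from the same constituent, hence of multidegree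
0; being a unit of `R_Q` alone would not suffice. -/
theorem isUnit_coord {x : PluckerIndex E r} (hx : IsBaseIndex Q x) : IsUnit (n.coord x) := by
  have hmem : ((n.unit x.1 : LaurentRing E r Q) *
      (((isUnit_laurentCoord hx).unit⁻¹ : (LaurentRing E r Q)ˣ) : LaurentRing E r Q)) ∈
      stratumRing E r Q := by
    refine ⟨Pi.single x.1 1, MvPolynomial.C (n.scalar x.1) *
        MvPolynomial.X ⟨_, n.isBaseIndex x.1⟩, MvPolynomial.X ⟨x, hx⟩, ?_, ?_,
        X_mem_variableMonoid _, ?_⟩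
    · have := (MvPolynomial.isWeightedHomogeneous_C (multidegree E r Q) (n.scalar x.1)).mul
        (MvPolynomial.isWeightedHomogeneous_X ℂ (multidegree E r Q) ⟨_, n.isBaseIndex x.1⟩)
      rwa [zero_add, multidegree, n.index_fst] at this
    · exact MvPolynomial.isWeightedHomogeneous_X ℂ (multidegree E r Q) ⟨x, hx⟩
    · rw [map_mul, ← laurentCoord_of_isBaseIndex, ← laurentCoord_of_isBaseIndex, mul_assoc,
        IsUnit.val_inv_mul, mul_one, coe_unit, Algebra.smul_def, ← MvPolynomial.algebraMap_eq,
        AlgHom.commutes]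
  refine IsUnit.of_mul_eq_one ⟨_, hmem⟩ (Subtype.ext ?_)
  change laurentCoord Q x * ((n.unit x.1)⁻¹ : (LaurentRing E r Q)ˣ) *
    ((n.unit x.1 : LaurentRing E r Q) *
      (((isUnit_laurentCoord hx).unit⁻¹ : (LaurentRing E r Q)ˣ) : LaurentRing E r Q)) = 1
  rw [mul_assoc, Units.inv_mul_cancel_left, IsUnit.mul_val_inv]

theorem scalar_smul_coord_index (i : Fin s) : n.scalar i • n.coord (n.index i) = 1 := by
  apply Subtype.ext
  change n.scalar i • (laurentCoord Q (n.index i) *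
    ((n.unit (n.index i).1)⁻¹ : (LaurentRing E r Q)ˣ)) = 1
  rw [← smul_mul_assoc, ← coe_unit, n.index_fst, Units.mul_inv]

/-- The product of powers of the normalizing units. -/
noncomputable def degUnit (d : Fin s → ℕ) : LaurentRing E r Q := ∏ i, (n.unit i : LaurentRing E r Q) ^ d i

theorem isUnit_degUnit (d : Fin s → ℕ) : IsUnit (n.degUnit d) :=
  IsUnit.prod_univ_iff.mpr fun i => (n.unit i).isUnit.pow _

/-- Each coordinate is its normalized version times the unit of its constituent, so a
multihomogeneous polynomial picks up a unit that depends only on its multidegree. -/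
theorem toLaurentRing_eq_degUnit_mul {d : Fin s → ℕ} {a : MvPolynomial (BaseIndex E r Q) ℂ}
    (ha : a.IsWeightedHomogeneous (multidegree E r Q) d) :
    toLaurentRing E r Q a =
      n.degUnit d * (MvPolynomial.aeval (R := ℂ) (fun x : BaseIndex E r Q => n.coord x.1) a : stratumRing E r Q) := by
  have hmon : ∀ μ : BaseIndex E r Q →₀ ℕ, (μ.prod fun x k => laurentCoord Q x.1 ^ k) =
      n.degUnit (Finsupp.weight (multidegree E r Q) μ) *
        ((μ.prod fun x k => n.coord x.1 ^ k : stratumRing E r Q) : LaurentRing E r Q) := by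
    intro μ
    induction μ using Finsupp.induction_linear with
    | zero => simp [degUnit]
    | add f g hf hg =>
      rw [Finsupp.prod_add_index' (by simp) (by simp [pow_add]), 
        Finsupp.prod_add_index' (by simp) (by simp [pow_add]), hf, hg, map_add]
      simp only [degUnit, Pi.add_apply, pow_add, Finset.prod_mul_distrib, MulMemClass.coe_mul]
      ring
    | single x k =>
      rw [Finsupp.prod_single_index (by simp), Finsupp.prod_single_index (by simp),
        Finsupp.weight_single, SubmonoidClass.coe_pow, coe_coord, mul_pow, degUnit,
        Finset.prod_eq_single x.1.1]
      · simp only [multidegree, Pi.smul_apply, Pi.single_eq_same, smul_eq_mul, mul_one]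
        rw [mul_left_comm, ← mul_pow, Units.mul_inv, one_pow, mul_one]
      · intro i _ hi
        simp [multidegree, hi]
      · simp
  have h1 : toLaurentRing E r Q a = MvPolynomial.aeval (R := ℂ) (fun x : BaseIndex E r Q => laurentCoord Q x.1) a := by
    have : toLaurentRing E r Q = MvPolynomial.aeval (R := ℂ) (fun x : BaseIndex E r Q => laurentCoord Q x.1) := by
      refine MvPolynomial.algHom_ext fun x => ?_
      rw [MvPolynomial.aeval_X, laurentCoord_of_isBaseIndex x.2]
    rw [this]
  rw [h1, MvPolynomial.aeval_def, MvPolynomial.aeval_def, MvPolynomial.eval₂_eq, MvPolynomial.eval₂_eq]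
  rw [AddSubmonoidClass.coe_finsetSum, Finset.mul_sum]
  refine Finset.sum_congr rfl fun μ hμ => ?_
  have hw := ha (MvPolynomial.mem_support_iff.mp hμ)
  have := hmon μ
  rw [hw] at this
  simp only [Finsupp.prod] at this
  rw [this, MulMemClass.coe_mul, mul_left_comm]
  rfl

/-- The stratum ring is generated by the normalized coordinates and their inverses. -/
theorem eq_top_of_coord_mem (T : Subalgebra ℂ (stratumRing E r Q))
    (hT : ∀ x, IsBaseIndex Q x → n.coord x ∈ T ∧ ∃ t ∈ T, n.coord x * t = 1) : T = ⊤ := by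
  rw [eq_top_iff]
  rintro ⟨f, hf⟩ -
  obtain ⟨d, a, m, ha, hm, hmS, h⟩ := id hf
  -- Numerator and denominator have the same multidegree, so their unit factors cancel.
  rw [n.toLaurentRing_eq_degUnit_mul ha, n.toLaurentRing_eq_degUnit_mul hm, mul_left_comm,
    (n.isUnit_degUnit d).mul_right_inj] at h
  let N : MvPolynomial (BaseIndex E r Q) ℂ →ₐ[ℂ] stratumRing E r Q :=
    MvPolynomial.aeval fun x : BaseIndex E r Q => n.coord x.1
  have hN : ∀ b, N b ∈ T := by
    intro b
    have : N.range ≤ T := by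
      rw [← Algebra.map_top, ← MvPolynomial.adjoin_range_X, AlgHom.map_adjoin, Algebra.adjoin_le_iff]
      rintro _ ⟨_, ⟨x, rfl⟩, rfl⟩
      simpa [N] using (hT x.1 x.2).1
    exact this ⟨b, rfl⟩
  have hinv : ∃ t ∈ T, N m * t = 1 := by
    refine Submonoid.closure_induction (motive := fun m _ => ∃ t ∈ T, N m * t = 1) ?_ ?_ ?_ hmS
    · rintro _ ⟨x, rfl⟩
      simpa [N] using (hT x.1 x.2).2
    · exact ⟨1, one_mem T, by simp⟩
    · rintro a b _ _ ⟨t, ht, h⟩ ⟨t', ht', h'⟩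
      refine ⟨t * t', mul_mem ht ht', ?_⟩
      rw [map_mul, mul_mul_mul_comm, h, h', one_mul]
  obtain ⟨t, ht, hmt⟩ := hinv
  have h' : (⟨f, hf⟩ : stratumRing E r Q) * N m = N a := Subtype.ext h
  have : (⟨f, hf⟩ : stratumRing E r Q) = N a * t := by
    rw [← h', mul_assoc, hmt, mul_one]
  rw [this]
  exact mul_mem (hN a) ht

end Normalizer

end Coordinates

/-! ### Plücker coordinates of complete flags in `ℂ⁴` and their incidence relations. -/

section Plucker

/-- The ground set `[4]`, as a type. -/
abbrev Ground : Type := (Set.univ : Set (Fin 4))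

/-- Indices of the Plücker coordinates of complete flags in `ℂ⁴`. -/
abbrev FlagIndex : Type := PluckerIndex (Set.univ : Set (Fin 4)) ![1, 2, 3]

/-- The index of the point coordinate `{j}`. -/
def pointIndex (j : Fin 4) : FlagIndex := ⟨0, {⟨j, trivial⟩}, rfl⟩

/-- The index of the line coordinate `{j, k}`. -/
def lineIndex (j k : Fin 4) (h : j < k) : FlagIndex :=
  ⟨1, {⟨j, trivial⟩, ⟨k, trivial⟩}, Finset.card_pair fun e => h.ne (congrArg Subtype.val e)⟩

/-- The index of the plane coordinate `[4] ∖ {j}`. -/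
def planeIndex (j : Fin 4) : FlagIndex :=
  ⟨2, {⟨j, trivial⟩}ᶜ, by rw [Finset.card_compl]; rfl⟩

theorem flagIndex_cases {motive : FlagIndex → Prop} (h0 : ∀ j, motive (pointIndex j))
    (h1 : ∀ j k h, motive (lineIndex j k h)) (h2 : ∀ j, motive (planeIndex j)) (x : FlagIndex) :
    motive x := by
  obtain ⟨i, l, hl⟩ := x
  fin_cases i
  · obtain ⟨⟨j, hj⟩, rfl⟩ := Finset.card_eq_one.mp hl
    exact h0 j
  · obtain ⟨⟨j, hj⟩, ⟨k, hk⟩, hjk, rfl⟩ := Finset.card_eq_two.mp hl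
    have hne : j ≠ k := fun e => hjk (Subtype.ext e)
    rcases lt_or_gt_of_ne hne with h | h
    · exact h1 j k h
    · have : (⟨1, {⟨j, hj⟩, ⟨k, hk⟩}, hl⟩ : FlagIndex) = lineIndex k j h :=
        congrArg (Sigma.mk (1 : Fin 3)) (Subtype.ext (Finset.pair_comm _ _))
      exact this ▸ h1 k j h
  · have hl' : lᶜ.card = 1 := by
      rw [Finset.card_compl, hl]
      rfl
    obtain ⟨⟨j, hj⟩, h⟩ := Finset.card_eq_one.mp hl'
    obtain rfl : l = {⟨j, hj⟩}ᶜ := by rw [← h, compl_compl]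
    exact h2 j

variable {S T : Type*} [CommRing S] [CommRing T]

/-- The point coordinates of a family. -/
def pointCoord (π : FlagIndex → S) (j : Fin 4) : S := π (pointIndex j)

/-- The antisymmetrized line coordinates of a family. -/
def lineCoord (π : FlagIndex → S) (j k : Fin 4) : S :=
  if h : j < k then π (lineIndex j k h) else if h : k < j then -π (lineIndex k j h) else 0

/-- The signed plane coordinates of a family, as coefficients of a linear form. -/
def planeCoord (π : FlagIndex → S) (j : Fin 4) : S := (-1) ^ (j : ℕ) * π (planeIndex j)

theorem map_pointCoord (φ : S →+* T) (π : FlagIndex → S) (j : Fin 4) :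
    φ (pointCoord π j) = pointCoord (fun x => φ (π x)) j := rfl

theorem map_lineCoord (φ : S →+* T) (π : FlagIndex → S) (j k : Fin 4) :
    φ (lineCoord π j k) = lineCoord (fun x => φ (π x)) j k := by
  unfold lineCoord
  split_ifs <;> simp

theorem map_planeCoord (φ : S →+* T) (π : FlagIndex → S) (j : Fin 4) :
    φ (planeCoord π j) = planeCoord (fun x => φ (π x)) j := by
  simp [planeCoord]

theorem lineCoord_of_lt (π : FlagIndex → S) {j k : Fin 4} (h : j < k) :
    lineCoord π j k = π (lineIndex j k h) := dif_pos h

theorem lineCoord_self (π : FlagIndex → S) (j : Fin 4) : lineCoord π j j = 0 := by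
  simp [lineCoord]

theorem lineCoord_swap (π : FlagIndex → S) (j k : Fin 4) : lineCoord π k j = -lineCoord π j k := by
  rcases lt_trichotomy j k with h | rfl | h
  · simp [lineCoord, h, h.not_gt]
  · simp [lineCoord_self]
  · simp [lineCoord, h, h.not_gt]

/-- The incidence relations between a point, a line and a plane. -/
structure IncidenceRelations (a : Fin 4 → S) (P : Fin 4 → Fin 4 → S) (b : Fin 4 → S) : Prop where
  point_line : ∀ i j k, a i * P j k - a j * P i k + a k * P i j = 0
  line : ∀ i j k l, P i j * P k l - P i k * P j l + P i l * P j k = 0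
  line_plane : ∀ i, ∑ j, b j * P i j = 0

theorem orderEmbOfFin_pointIndex (j : Fin 4) (m : Fin 1) :
    (pointIndex j).2.1.orderEmbOfFin (pointIndex j).2.2 m = ⟨j, trivial⟩ := by
  have := Finset.orderEmbOfFin_mem (pointIndex j).2.1 (pointIndex j).2.2 m
  exact Finset.mem_singleton.mp this

theorem orderEmbOfFin_lineIndex (j k : Fin 4) (h : j < k) (m : Fin 2) :
    (lineIndex j k h).2.1.orderEmbOfFin (lineIndex j k h).2.2 m = ⟨![j, k] m, trivial⟩ := by
  have := Finset.orderEmbOfFin_unique (s := (lineIndex j k h).2.1) (k := 2) (lineIndex j k h).2.2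
    (f := fun m => ⟨![j, k] m, trivial⟩)
    (fun x => by fin_cases x <;> simp [lineIndex])
    (fun x y hxy => by
      fin_cases x <;> fin_cases y <;> first | exact absurd hxy (by decide) | exact h)
  exact (congrFun this m).symm

theorem orderEmbOfFin_planeIndex (j : Fin 4) (m : Fin 3) :
    (planeIndex j).2.1.orderEmbOfFin (planeIndex j).2.2 m = ⟨j.succAbove m, trivial⟩ := by
  have := Finset.orderEmbOfFin_unique (s := (planeIndex j).2.1) (k := 3) (planeIndex j).2.2
    (f := fun m => ⟨j.succAbove m, trivial⟩)
    (fun x => by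
      simpa [planeIndex] using fun e => Fin.succAbove_ne j x (congrArg Subtype.val e))
    (fun x y hxy => Fin.strictMono_succAbove j hxy)
  exact (congrFun this m).symm

/-- The coordinates of a tuple of maximal minors. -/
theorem pointCoord_of_minors {p : FlagIndex → S} {c : S} {v : Fin 1 → Ground → S}
    (h : ∀ l : {l : Finset Ground // l.card = 1}, p ⟨0, l⟩ = c * Matrix.det
      (Matrix.of fun i j => v i (l.1.orderEmbOfFin l.2 j))) (j : Fin 4) :
    pointCoord p j = c * v 0 ⟨j, trivial⟩ := by
  refine (h (pointIndex j).2).trans ?_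
  rw [Matrix.det_fin_one, Matrix.of_apply]
  exact congrArg (fun y => c * v 0 y) (orderEmbOfFin_pointIndex j 0)

theorem lineCoord_of_minors {p : FlagIndex → S} {c : S} {v : Fin 2 → Ground → S}
    (h : ∀ l : {l : Finset Ground // l.card = 2}, p ⟨1, l⟩ = c * Matrix.det
      (Matrix.of fun i j => v i (l.1.orderEmbOfFin l.2 j))) (j k : Fin 4) :
    lineCoord p j k = c * (v 0 ⟨j, trivial⟩ * v 1 ⟨k, trivial⟩ -
      v 0 ⟨k, trivial⟩ * v 1 ⟨j, trivial⟩) := by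
  have key : ∀ j k, j < k → lineCoord p j k = c * (v 0 ⟨j, trivial⟩ * v 1 ⟨k, trivial⟩ -
      v 0 ⟨k, trivial⟩ * v 1 ⟨j, trivial⟩) := by
    intro j k hjk
    rw [lineCoord_of_lt _ hjk]
    refine (h (lineIndex j k hjk).2).trans ?_
    have h2 : (fun m => (lineIndex j k hjk).2.1.orderEmbOfFin (lineIndex j k hjk).2.2 m) =
      fun m : Fin 2 => ⟨![j, k] m, trivial⟩ := funext (orderEmbOfFin_lineIndex j k hjk)
    have h3 := congrArg (fun f : Fin 2 → Ground =>
      c * Matrix.det (Matrix.of fun i j => v i (f j))) h2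
    refine h3.trans ?_
    simp [Matrix.det_fin_two]
  rcases lt_trichotomy j k with h | rfl | h
  · exact key j k h
  · rw [lineCoord_self]; ring
  · rw [lineCoord_swap, key k j h]; ring

theorem planeCoord_of_minors {p : FlagIndex → S} {c : S} {v : Fin 3 → Ground → S}
    (h : ∀ l : {l : Finset Ground // l.card = 3}, p ⟨2, l⟩ = c * Matrix.det
      (Matrix.of fun i j => v i (l.1.orderEmbOfFin l.2 j))) (j : Fin 4) :
    planeCoord p j = c * ((-1) ^ (j : ℕ) *
      Matrix.det (Matrix.of fun i m : Fin 3 => v i ⟨j.succAbove m, trivial⟩)) := by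
  have h2 : (fun m => (planeIndex j).2.1.orderEmbOfFin (planeIndex j).2.2 m) =
      fun m : Fin 3 => ⟨j.succAbove m, trivial⟩ := funext (orderEmbOfFin_planeIndex j)
  have h3 := congrArg (fun f : Fin 3 → Ground =>
      c * Matrix.det (Matrix.of fun i j => v i (f j))) h2
  have h4 : p (planeIndex j) = _ := (h (planeIndex j).2).trans h3
  rw [planeCoord, h4, mul_left_comm]

/-- The signed maximal minors of three vectors are orthogonal to each of them. -/
theorem sum_minors_mul (v : Fin 3 → Fin 4 → S) (i : Fin 3) :
    ∑ j : Fin 4, ((-1) ^ (j : ℕ) *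
      Matrix.det (Matrix.of fun i m : Fin 3 => v i (j.succAbove m))) * v i j = 0 := by
  have h : ∀ j : Fin 4, (j.succAbove 0, j.succAbove 1, j.succAbove 2) =
    ![((1 : Fin 4), (2 : Fin 4), (3 : Fin 4)), (0, 2, 3), (0, 1, 3), (0, 1, 2)] j := by decide
  simp only [Prod.ext_iff] at h
  simp only [Fin.sum_univ_four, Matrix.det_fin_three, Matrix.of_apply, h]
  fin_cases i <;> simp <;> ring

/-- The Plücker coordinates of a flag satisfy the incidence relations. -/
theorem incidenceRelations_of_rows {a b : Fin 4 → S} {P : Fin 4 → Fin 4 → S} {x : Fin 4 → S}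
    {u : Fin 2 → Fin 4 → S} {w : Fin 3 → Fin 4 → S} {c₀ c₁ c₂ : S}
    (ha : ∀ j, a j = c₀ * x j) (hP : ∀ j k, P j k = c₁ * (u 0 j * u 1 k - u 0 k * u 1 j))
    (hb : ∀ j, b j = c₂ * ((-1) ^ (j : ℕ) *
      Matrix.det (Matrix.of fun i m : Fin 3 => w i (j.succAbove m))))
    (hx : ∃ s t : S, ∀ j, x j = s * u 0 j + t * u 1 j)
    (hu : ∀ i, ∃ s t y : S, ∀ j, u i j = s * w 0 j + t * w 1 j + y * w 2 j) :
    IncidenceRelations a P b := by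
  have hbw : ∀ i, ∑ j, b j * w i j = 0 := fun i => by
    have h := congrArg (c₂ * ·) (sum_minors_mul w i)
    simp only [Finset.mul_sum, mul_zero] at h
    rw [← h]
    exact Finset.sum_congr rfl fun j _ => by rw [hb, mul_assoc]
  have hbu : ∀ i, ∑ j, b j * u i j = 0 := fun i => by
    obtain ⟨s, t, y, h⟩ := hu i
    have h0 : ∀ j, b j * u i j = s * (b j * w 0 j) + t * (b j * w 1 j) + y * (b j * w 2 j) :=
      fun j => by rw [h]; ring
    simp only [h0, Finset.sum_add_distrib, ← Finset.mul_sum, hbw, mul_zero, add_zero]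
  refine ⟨fun i j k => ?_, fun i j k l => ?_, fun i => ?_⟩
  · obtain ⟨s, t, h⟩ := hx
    simp only [ha, hP, h]
    ring
  · simp only [hP]
    ring
  · have h0 : ∀ j, b j * P i j = c₁ * u 0 i * (b j * u 1 j) - c₁ * u 1 i * (b j * u 0 j) :=
      fun j => by rw [hP]; ring
    simp only [h0, Finset.sum_sub_distrib, ← Finset.mul_sum, hbu, mul_zero, sub_zero]

/-- The inclusions of the flag express the point in the basis of the line, and the basis of the line
in that of the plane; the relations are then identities between minors. -/
theorem incidenceRelations_of_mem_flagCone {p : FlagIndex → ℂ}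
    (hp : p ∈ flagCone Set.univ ![1, 2, 3]) :
    IncidenceRelations (pointCoord p) (lineCoord p) (planeCoord p) := by
  obtain ⟨F, hF, hp⟩ := hp
  obtain ⟨x, c₀, -, h0⟩ := hp 0
  obtain ⟨u, c₁, -, h1⟩ := hp 1
  obtain ⟨w, c₂, -, h2⟩ := hp 2
  change Module.Basis (Fin 1) ℂ (F 0) at x
  change Module.Basis (Fin 2) ℂ (F 1) at u
  change Module.Basis (Fin 3) ℂ (F 2) at w
  refine incidenceRelations_of_rows (x := fun j => (x 0 : Ground → ℂ) ⟨j, trivial⟩)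
    (u := fun i j => (u i : Ground → ℂ) ⟨j, trivial⟩)
    (w := fun i j => (w i : Ground → ℂ) ⟨j, trivial⟩)
    (pointCoord_of_minors (v := fun i => (x i : Ground → ℂ)) h0)
    (lineCoord_of_minors (v := fun i => (u i : Ground → ℂ)) h1)
    (planeCoord_of_minors (v := fun i => (w i : Ground → ℂ)) h2) ?_ fun i => ?_
  · have := u.sum_repr ⟨x 0, hF (by decide : (0 : Fin 3) ≤ 1) (x 0).2⟩
    rw [Fin.sum_univ_two] at this
    exact ⟨_, _, fun j => (congrFun (congrArg Subtype.val this) ⟨j, trivial⟩).symm⟩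
  · have := w.sum_repr ⟨u i, hF (by decide : (1 : Fin 3) ≤ 2) (u i).2⟩
    rw [Fin.sum_univ_three] at this
    exact ⟨_, _, _, fun j => (congrFun (congrArg Subtype.val this) ⟨j, trivial⟩).symm⟩

end Plucker

/-! ### The incidence relations in the stratum ring. -/

section Strata

theorem mem_flagIdeal_iff {g : MvPolynomial FlagIndex ℂ} : g ∈ flagIdeal Set.univ ![1, 2, 3] ↔
    ∀ p ∈ flagCone Set.univ ![1, 2, 3], MvPolynomial.aeval p g = 0 :=
  MvPolynomial.mem_vanishingIdeal_iff

variable (Q : Fin 3 → Matroid (Fin 4))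

/-- Each relation is a polynomial in the universal coordinates vanishing on the whole multi-cone, so
it lies in `flagIdeal` by definition of a vanishing ideal. -/
theorem incidenceRelations_laurentCoord :
    IncidenceRelations (pointCoord (S := LaurentRing Set.univ ![1, 2, 3] Q) (laurentCoord Q))
      (lineCoord (laurentCoord Q)) (planeCoord (laurentCoord Q)) := by
  let X : FlagIndex → MvPolynomial FlagIndex ℂ := MvPolynomial.X
  let φ : MvPolynomial FlagIndex ℂ →ₐ[ℂ] LaurentRing Set.univ ![1, 2, 3] Q :=
    MvPolynomial.aeval (laurentCoord Q)
  have hφ : ∀ g, (∀ p ∈ flagCone Set.univ ![1, 2, 3], MvPolynomial.aeval p g = 0) → φ g = 0 :=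
    fun g hg => aeval_laurentCoord (mem_flagIdeal_iff.mpr hg)
  have h0 : ∀ j, pointCoord (laurentCoord Q) j = φ (pointCoord X j) := fun j => by
    refine Eq.trans ?_ (map_pointCoord φ.toRingHom X j).symm
    simp [φ, X]
  have h1 : ∀ j k, lineCoord (laurentCoord Q) j k = φ (lineCoord X j k) := fun j k => by
    refine Eq.trans ?_ (map_lineCoord φ.toRingHom X j k).symm
    simp [φ, X]
  have h2 : ∀ j, planeCoord (laurentCoord Q) j = φ (planeCoord X j) := fun j => by
    refine Eq.trans ?_ (map_planeCoord φ.toRingHom X j).symm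
    simp [φ, X]
  have e0 : ∀ (p : FlagIndex → ℂ) j, MvPolynomial.aeval p (pointCoord X j) = pointCoord p j :=
    fun p j => by
      refine (map_pointCoord (MvPolynomial.aeval p).toRingHom X j).trans ?_
      simp [X]
  have e1 : ∀ (p : FlagIndex → ℂ) j k,
      MvPolynomial.aeval p (lineCoord X j k) = lineCoord p j k := fun p j k => by
    refine (map_lineCoord (MvPolynomial.aeval p).toRingHom X j k).trans ?_
    simp [X]
  have e2 : ∀ (p : FlagIndex → ℂ) j, MvPolynomial.aeval p (planeCoord X j) = planeCoord p j :=
    fun p j => by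
      refine (map_planeCoord (MvPolynomial.aeval p).toRingHom X j).trans ?_
      simp [X]
  refine ⟨fun i j k => ?_, fun i j k l => ?_, fun i => ?_⟩
  · simp only [h0, h1, ← map_mul, ← map_sub, ← map_add]
    refine hφ _ fun p hp => ?_
    simp only [map_mul, map_sub, map_add, e0, e1]
    exact (incidenceRelations_of_mem_flagCone hp).point_line i j k
  · simp only [h1, ← map_mul, ← map_sub, ← map_add]
    refine hφ _ fun p hp => ?_
    simp only [map_mul, map_sub, map_add, e1]
    exact (incidenceRelations_of_mem_flagCone hp).line i j k l
  · simp only [h1, h2, ← map_mul, ← map_sum]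
    refine hφ _ fun p hp => ?_
    simp only [map_mul, map_sum, e1, e2]
    exact (incidenceRelations_of_mem_flagCone hp).line_plane i

variable {Q}
variable (n : Normalizer (Set.univ : Set (Fin 4)) ![1, 2, 3] Q)

theorem coe_pointCoord_coord (j : Fin 4) : ((pointCoord n.coord j : stratumRing Set.univ ![1, 2, 3] Q) :
      LaurentRing Set.univ ![1, 2, 3] Q) =
    pointCoord (laurentCoord Q) j * ((n.unit 0)⁻¹ : (LaurentRing Set.univ ![1, 2, 3] Q)ˣ) := rfl

theorem coe_lineCoord_coord (j k : Fin 4) :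
    ((lineCoord n.coord j k : stratumRing Set.univ ![1, 2, 3] Q) :
      LaurentRing Set.univ ![1, 2, 3] Q) =
    lineCoord (laurentCoord Q) j k * ((n.unit 1)⁻¹ : (LaurentRing Set.univ ![1, 2, 3] Q)ˣ) := by
  refine (map_lineCoord (stratumRing Set.univ ![1, 2, 3] Q).val.toRingHom n.coord j k).trans ?_
  unfold lineCoord
  split_ifs
  · rfl
  · rw [neg_mul]
    rfl
  · rw [zero_mul]

theorem coe_planeCoord_coord (j : Fin 4) :
    ((planeCoord n.coord j : stratumRing Set.univ ![1, 2, 3] Q) :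
      LaurentRing Set.univ ![1, 2, 3] Q) =
    planeCoord (laurentCoord Q) j * ((n.unit 2)⁻¹ : (LaurentRing Set.univ ![1, 2, 3] Q)ˣ) := by
  refine (map_planeCoord (stratumRing Set.univ ![1, 2, 3] Q).val.toRingHom n.coord j).trans ?_
  unfold planeCoord
  rw [mul_assoc]
  rfl

/-- The relations are multihomogeneous, so they survive rescaling each constituent by a unit. -/
theorem incidenceRelations_coord :
    IncidenceRelations (pointCoord n.coord) (lineCoord n.coord) (planeCoord n.coord) := by
  have h := incidenceRelations_laurentCoord Q
  refine ⟨fun i j k => Subtype.ext ?_, fun i j k l => Subtype.ext ?_, fun i => Subtype.ext ?_⟩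
  · push_cast [coe_pointCoord_coord, coe_lineCoord_coord]
    linear_combination (((n.unit 0)⁻¹ : (LaurentRing Set.univ ![1, 2, 3] Q)ˣ) : LaurentRing Set.univ ![1, 2, 3] Q) *
      (((n.unit 1)⁻¹ : (LaurentRing Set.univ ![1, 2, 3] Q)ˣ) : LaurentRing Set.univ ![1, 2, 3] Q) * h.point_line i j k
  · push_cast [coe_lineCoord_coord]
    linear_combination (((n.unit 1)⁻¹ : (LaurentRing Set.univ ![1, 2, 3] Q)ˣ) : LaurentRing Set.univ ![1, 2, 3] Q) ^ 2
      * h.line i j k l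
  · have h' := h.line_plane i
    rw [Fin.sum_univ_four] at h' ⊢
    push_cast [coe_lineCoord_coord, coe_planeCoord_coord]
    linear_combination (((n.unit 1)⁻¹ : (LaurentRing Set.univ ![1, 2, 3] Q)ˣ) : LaurentRing Set.univ ![1, 2, 3] Q) *
      (((n.unit 2)⁻¹ : (LaurentRing Set.univ ![1, 2, 3] Q)ˣ) : LaurentRing Set.univ ![1, 2, 3] Q) * h'

end Strata

/-! ### Flags from incident points, lines and planes over `ℂ`. -/

section Points

/-- A plane through a line is spanned by the line and one further vector, and its Plücker
coordinates are those of the linear form which cuts it out. -/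
theorem exists_third_row {a v b : Fin 4 → ℂ} {i r : Fin 4} (hir : a i * v r - a r * v i ≠ 0)
    (h : ∀ s, ∑ j, b j * (a s * v j - a j * v s) = 0) :
    ∃ (w : Fin 4 → ℂ) (κ : ℂ), κ ≠ 0 ∧ ∀ j : Fin 4, (-1) ^ (j : ℕ) *
      Matrix.det (Matrix.of fun i m : Fin 3 => ![a, v, w] i (j.succAbove m)) = κ * b j := by
  have hs : ∀ j : Fin 4, (j.succAbove 0, j.succAbove 1, j.succAbove 2) =
    ![((1 : Fin 4), (2 : Fin 4), (3 : Fin 4)), (0, 2, 3), (0, 1, 3), (0, 1, 2)] j := by decide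
  simp only [Prod.ext_iff] at hs
  simp only [Fin.sum_univ_four] at h
  have h0 := h 0
  have h1 := h 1
  have h2 := h 2
  have h3 := h 3
  simp only [Matrix.det_fin_three, Matrix.of_apply, hs]
  clear h hs
  wlog hlt : i < r generalizing i r
  · refine this (i := r) (r := i) ?_ ?_
    · intro e
      exact hir (by linear_combination -e)
    · rcases lt_trichotomy i r with h | rfl | h
      · exact absurd h hlt
      · exact absurd (by ring) hir
      · exact h
  fin_cases i <;> fin_cases r <;> first | exact absurd hlt (by decide) | skip
  -- In all six cases `w` is supported off `{i, r}` and annihilated by `b`, with the sign for which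
  -- `κ` is the minor of the line at `i, r`.
  · refine ⟨![0, 0, -b 3, b 2], _, hir, fun j => ?_⟩
    fin_cases j <;> simp <;> first | ring1 | linear_combination h0 | linear_combination h1 | linear_combination -h0
  · refine ⟨![0, b 3, 0, -b 1], _, hir, fun j => ?_⟩
    fin_cases j <;> simp <;> first | ring1 | linear_combination h0 | linear_combination h2 | linear_combination -h0
  · refine ⟨![0, -b 2, b 1, 0], _, hir, fun j => ?_⟩
    fin_cases j <;> simp <;> first | ring1 | linear_combination h0 | linear_combination h3 | linear_combination -h0
  · refine ⟨![-b 3, 0, 0, b 0], _, hir, fun j => ?_⟩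
    fin_cases j <;> simp <;> first | ring1 | linear_combination h1 | linear_combination h2 | linear_combination -h1
  · refine ⟨![b 2, 0, -b 0, 0], _, hir, fun j => ?_⟩
    fin_cases j <;> simp <;> first | ring1 | linear_combination h1 | linear_combination h3 | linear_combination -h1
  · refine ⟨![-b 1, b 0, 0, 0], _, hir, fun j => ?_⟩
    fin_cases j <;> simp <;> first | ring1 | linear_combination h2 | linear_combination h3 | linear_combination -h2

/-- The flag spanned by the rows of a matrix. -/
theorem exists_mem_flagCone_of_rows {v : Fin 3 → Fin 4 → ℂ} {j : Fin 4}
    (hv : Matrix.det (Matrix.of fun i m : Fin 3 => v i (j.succAbove m)) ≠ 0) (c : Fin 3 → ℂ)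
    (hc : ∀ i, c i ≠ 0) :
    ∃ p ∈ flagCone (Set.univ : Set (Fin 4)) ![1, 2, 3],
      (∀ j, pointCoord p j = c 0 * v 0 j) ∧
      (∀ j k, lineCoord p j k = c 1 * (v 0 j * v 1 k - v 0 k * v 1 j)) ∧
      ∀ j, planeCoord p j = c 2 * ((-1) ^ (j : ℕ) *
        Matrix.det (Matrix.of fun i m : Fin 3 => v i (j.succAbove m))) := by
  let V : Fin 3 → Ground → ℂ := fun i y => v i y.1
  have hV : LinearIndependent ℂ V := by
    have h := Matrix.linearIndependent_rows_of_det_ne_zero hv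
    exact LinearIndependent.of_comp (LinearMap.funLeft ℂ ℂ fun m : Fin 3 =>
      (⟨j.succAbove m, trivial⟩ : Ground)) h
  have hle : ∀ i : Fin 3, (![1, 2, 3] : Fin 3 → ℕ) i ≤ 3 := by decide
  have hmono : ∀ i j : Fin 3, i ≤ j → (![1, 2, 3] : Fin 3 → ℕ) i ≤ (![1, 2, 3] : Fin 3 → ℕ) j := by
    decide
  let W : (i : Fin 3) → Fin ((![1, 2, 3] : Fin 3 → ℕ) i) → Ground → ℂ :=
    fun i m => V (Fin.castLE (hle i) m)
  have hW : ∀ i, LinearIndependent ℂ (W i) := fun i =>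
    hV.comp _ (Fin.castLE_injective (hle i))
  let p : FlagIndex → ℂ := fun x => c x.1 * Matrix.det (Matrix.of fun i j => W x.1 i (x.2.1.orderEmbOfFin x.2.2 j))
  refine ⟨p, ⟨fun i => Submodule.span ℂ (Set.range (W i)), ?_, fun i => ?_⟩, ?_, ?_, ?_⟩
  · intro i k hik
    refine Submodule.span_mono ?_
    rintro _ ⟨m, rfl⟩
    exact ⟨Fin.castLE (hmono i k hik) m, rfl⟩
  · refine ⟨Module.Basis.span (hW i), c i, hc i, fun l => ?_⟩
    simp only [Module.Basis.span_apply]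
    rfl
  · exact pointCoord_of_minors (p := p) (v := W 0) fun l => rfl
  · exact lineCoord_of_minors (p := p) (v := W 1) fun l => rfl
  · exact planeCoord_of_minors (p := p) (v := W 2) fun l => rfl

/-- Incident points, lines and planes form a flag. -/
theorem exists_mem_flagCone {a v b : Fin 4 → ℂ} {i r : Fin 4} (hir : a i * v r - a r * v i ≠ 0)
    (h : ∀ s, ∑ j, b j * (a s * v j - a j * v s) = 0) (hb : ∃ j, b j ≠ 0) :
    ∃ p ∈ flagCone (Set.univ : Set (Fin 4)) ![1, 2, 3], (∀ j, pointCoord p j = a j) ∧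
      (∀ j k, lineCoord p j k = a j * v k - a k * v j) ∧ ∀ j, planeCoord p j = b j := by
  obtain ⟨w, κ, hκ, hw⟩ := exists_third_row hir h
  obtain ⟨j, hj⟩ := hb
  have hdet : Matrix.det (Matrix.of fun i m : Fin 3 => ![a, v, w] i (j.succAbove m)) ≠ 0 := by
    intro e
    have := hw j
    rw [e, mul_zero] at this
    exact mul_ne_zero hκ hj this.symm
  -- Plücker vectors are free up to scale, and `κ⁻¹` cancels the factor between the minors and `b`.
  obtain ⟨p, hp, h0, h1, h2⟩ := exists_mem_flagCone_of_rows hdet ![1, 1, κ⁻¹]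
    (by intro i; fin_cases i <;> simp [hκ])
  refine ⟨p, hp, fun j => by simp [h0], fun j k => by simp [h1], fun j => ?_⟩
  rw [h2, hw]
  simp [hκ]

end Points

/-! ### The parametrization attached to a chart. -/

/-- The combinatorial data from which a flag of given support is parametrized: `A j`, `G j k`,
`B j` say that the `j`-th point coordinate, the `{j, k}`-th line coordinate and the `j`-th
coefficient of the plane are nonzero. The columns `i`, `r` of the line are normalized to a standard
basis, and the coefficients of the plane at `d`, `e` are expressed through the others, of which the
`c`-th is normalized to `1`. -/
structure FlagChart (A B : Fin 4 → Prop) (G : Fin 4 → Fin 4 → Prop) where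
  symm : ∀ {j k}, G j k → G k j
  irrefl : ∀ j, ¬ G j j
  trans : ∀ {j k l}, (∃ s, G k s) → ¬ G j k → ¬ G k l → ¬ G j l
  (i r d e c : Fin 4)
  point_i : A i
  line_i_r : G i r
  point_iff : ∀ j, A j ↔ G j r ∨ (A r ∧ G i j)
  line_d_e : G d e
  plane_c : B c
  c_ne_d : c ≠ d
  c_ne_e : c ≠ e
  not_line_e : ¬ B d → ∀ j, B j → ¬ G e j
  not_line_d : ¬ B e → ∀ j, B j → ¬ G d j
  exists_line_e : B d → ∃ j, B j ∧ j ≠ d ∧ j ≠ e ∧ G e j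
  exists_line_d : B e → ∃ j, B j ∧ j ≠ d ∧ j ≠ e ∧ G d j

/-- Names for the parameters: magnitudes and slopes of the columns of the line, coefficients of the
plane, and the position of the point on the line. -/
abbrev FlagParam : Type := (Fin 4 ⊕ Fin 4) ⊕ (Fin 4 ⊕ Unit)

namespace FlagParam

/-- The magnitude of the `j`-th column. -/
abbrev mag (j : Fin 4) : FlagParam := Sum.inl (Sum.inl j)

/-- The slope of the parallel class represented by `j`. -/
abbrev slope (j : Fin 4) : FlagParam := Sum.inl (Sum.inr j)

/-- The `j`-th coefficient of the plane. -/
abbrev form (j : Fin 4) : FlagParam := Sum.inr (Sum.inl j)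

/-- The position of the point on the line. -/
abbrev pos : FlagParam := Sum.inr (Sum.inr ())

end FlagParam

namespace FlagChart

open FlagParam

variable {A B : Fin 4 → Prop} {G : Fin 4 → Fin 4 → Prop} (c : FlagChart A B G)

include c in
theorem not_symm {j k : Fin 4} (h : ¬ G j k) : ¬ G k j := fun h' => h (c.symm h')

/-- Columns which are nonzero and parallel to neither of the two normalized columns. -/
def Generic (j : Fin 4) : Prop := G j c.r ∧ G c.i j

/-- A representative of the parallel class of `j`. -/
noncomputable def rep (j : Fin 4) : Fin 4 := Classical.epsilon fun k => c.Generic k ∧ ¬ G k j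

variable {c}

theorem rep_spec {j : Fin 4} (hj : c.Generic j) : c.Generic (c.rep j) ∧ ¬ G (c.rep j) j :=
  Classical.epsilon_spec (p := fun k => c.Generic k ∧ ¬ G k j) ⟨j, hj, c.irrefl j⟩

/-- Parallel columns have the same parallel class, so the two predicates under `Classical.epsilon`
are equal, and with them the choices. -/
theorem rep_eq_of_not_line {j k : Fin 4} (hj : c.Generic j) (hk : c.Generic k) (h : ¬ G j k) :
    c.rep j = c.rep k := by
  have : (fun x => c.Generic x ∧ ¬ G x j) = fun x => c.Generic x ∧ ¬ G x k := by
    ext x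
    exact and_congr_right fun _ => ⟨fun h' => c.trans ⟨_, hj.1⟩ h' h,
      fun h' => c.trans ⟨_, hk.1⟩ h' (c.not_symm h)⟩
  rw [rep, rep, this]

theorem not_line_of_rep_eq {j k : Fin 4} (hj : c.Generic j) (hk : c.Generic k)
    (h : c.rep j = c.rep k) : ¬ G j k := by
  have h1 := rep_spec hj
  have h2 := rep_spec hk
  rw [← h] at h2
  exact c.trans ⟨_, h1.1.1⟩ (c.not_symm h1.2) h2.2

theorem rep_rep {j : Fin 4} (hj : c.Generic j) : c.rep (c.rep j) = c.rep j :=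
  rep_eq_of_not_line (rep_spec hj).1 hj (rep_spec hj).2

/-- A nonzero column cannot be parallel to both `i` and `r`, because these are not parallel to each
other. -/
theorem line_r_or_line_i {j k : Fin 4} (h : G j k) : G j c.r ∨ G c.i j := by
  by_contra! h'
  exact c.trans ⟨k, h⟩ h'.2 h'.1 c.line_i_r

variable (c)

/-- The parameters which occur. -/
def Valid : FlagParam → Prop :=
  Sum.elim
    (Sum.elim (fun j => j ≠ c.i ∧ j ≠ c.r ∧ (G j c.r ∨ G c.i j))
      fun k => c.Generic k ∧ c.rep k = k)
    (Sum.elim (fun j => B j ∧ j ≠ c.c ∧ j ≠ c.d ∧ j ≠ c.e) fun _ => A c.r)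

/-- The type of parameters which occur. -/
abbrev Coord : Type := {s : FlagParam // c.Valid s}

noncomputable instance : Fintype c.Coord := Fintype.ofFinite _

section Formulas

variable {S T : Type*} [CommRing S] [CommRing T]

open Classical in
/-- Extension of parameter values by zero. -/
noncomputable def extend (t : c.Coord → S) (s : FlagParam) : S :=
  if h : c.Valid s then t ⟨s, h⟩ else 0

variable (t : FlagParam → S)

open Classical in
/-- The first row of the line. -/
noncomputable def fstRow (j : Fin 4) : S :=
  if G j c.r then (if j = c.i then 1 else t (mag j)) else 0

open Classical in
/-- The second row of the line. -/
noncomputable def sndRow (j : Fin 4) : S :=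
  if G c.i j then
    (if j = c.r then 1 else if G j c.r then t (mag j) * t (slope (c.rep j)) else t (mag j))
  else 0

/-- The coordinates of the line. -/
noncomputable def line (j k : Fin 4) : S :=
  c.fstRow t j * c.sndRow t k - c.fstRow t k * c.sndRow t j

/-- The coordinates of the point. -/
noncomputable def point (j : Fin 4) : S := c.fstRow t j + t pos * c.sndRow t j

/-- The free coefficients of the plane. -/
def free (j : Fin 4) : S := if j = c.c then 1 else t (form j)

/-- The numerators of the dependent coefficients of the plane. -/
noncomputable def num (s : Fin 4) : S :=
  -∑ j with j ≠ c.d ∧ j ≠ c.e, c.free t j * c.line t s j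

variable {t}

theorem map_extend (φ : S →+* T) (t : c.Coord → S) :
    (fun s => φ (c.extend t s)) = c.extend fun s => φ (t s) := by
  ext s
  unfold extend
  split_ifs <;> simp

theorem map_fstRow (φ : S →+* T) (j : Fin 4) :
    φ (c.fstRow t j) = c.fstRow (fun s => φ (t s)) j := by
  unfold fstRow
  split_ifs <;> simp

theorem map_sndRow (φ : S →+* T) (j : Fin 4) :
    φ (c.sndRow t j) = c.sndRow (fun s => φ (t s)) j := by
  unfold sndRow
  split_ifs <;> simp

theorem map_line (φ : S →+* T) (j k : Fin 4) :
    φ (c.line t j k) = c.line (fun s => φ (t s)) j k := by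
  simp only [line, map_sub, map_mul, map_fstRow, map_sndRow]

theorem map_point (φ : S →+* T) (j : Fin 4) :
    φ (c.point t j) = c.point (fun s => φ (t s)) j := by
  simp only [point, map_add, map_mul, map_fstRow, map_sndRow]

theorem map_free (φ : S →+* T) (j : Fin 4) :
    φ (c.free t j) = c.free (fun s => φ (t s)) j := by
  unfold free
  split_ifs <;> simp

theorem map_num (φ : S →+* T) (s : Fin 4) :
    φ (c.num t s) = c.num (fun s => φ (t s)) s := by
  simp only [num, map_neg, map_sum, map_mul, map_line, map_free]

theorem fstRow_eq_zero {j : Fin 4} (h : ¬ G j c.r) : c.fstRow t j = 0 := if_neg h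

theorem sndRow_eq_zero {j : Fin 4} (h : ¬ G c.i j) : c.sndRow t j = 0 := if_neg h

theorem line_self (j : Fin 4) : c.line t j j = 0 := sub_self _

theorem ne_i_of_generic {j : Fin 4} (h : c.Generic j) : j ≠ c.i := fun e =>
  c.irrefl j (e ▸ h.2 : G j j)

theorem ne_r_of_generic {j : Fin 4} (h : c.Generic j) : j ≠ c.r := fun e =>
  c.irrefl j (e ▸ h.1 : G j j)

/-- A zero column kills the minor. Otherwise the columns are parallel: both have first entry zero,
or both have second entry zero, or both are generic and share one slope through their common
representative. -/
theorem line_eq_zero {j k : Fin 4} (h : ¬ G j k) : c.line t j k = 0 := by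
  by_cases hj : ∃ s, G j s
  swap
  · push Not at hj
    rw [line, fstRow_eq_zero c (hj _), sndRow_eq_zero c (c.not_symm (hj _))]
    ring
  by_cases hk : ∃ s, G k s
  swap
  · push Not at hk
    rw [line, c.fstRow_eq_zero (hk _), c.sndRow_eq_zero (c.not_symm (hk _))]
    ring
  have h' := c.not_symm h
  by_cases h1 : G j c.r
  swap
  · rw [line, c.fstRow_eq_zero h1, c.fstRow_eq_zero (c.trans hj h' h1)]
    ring
  by_cases h2 : G c.i j
  swap
  · rw [line, c.sndRow_eq_zero h2, c.sndRow_eq_zero (c.trans hj h2 h)]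
    ring
  have h3 : G k c.r := by
    by_contra h3
    exact c.trans hk h h3 h1
  have h4 : G c.i k := by
    by_contra h4
    exact c.trans hk h4 h' h2
  have gj : c.Generic j := ⟨h1, h2⟩
  have gk : c.Generic k := ⟨h3, h4⟩
  simp only [line, fstRow, sndRow, if_pos h1, if_pos h2, if_pos h3, if_pos h4,
    if_neg (c.ne_i_of_generic gj), if_neg (c.ne_r_of_generic gj),
    if_neg (c.ne_i_of_generic gk), if_neg (c.ne_r_of_generic gk), rep_eq_of_not_line gj gk h]
  ring

theorem extend_of_valid {t : c.Coord → S} {s : FlagParam} (h : c.Valid s) :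
    c.extend t s = t ⟨s, h⟩ := dif_pos h

theorem extend_of_not_valid {t : c.Coord → S} {s : FlagParam} (h : ¬ c.Valid s) :
    c.extend t s = 0 := dif_neg h

/-- By `point_iff` the first entry of column `j` vanishes, and either the position parameter is
absent (read as 0) or the second entry vanishes as well. -/
theorem point_eq_zero {t : c.Coord → S} {j : Fin 4} (h : ¬ A j) : c.point (c.extend t) j = 0 := by
  rw [c.point_iff, not_or, not_and_or] at h
  rw [point, c.fstRow_eq_zero h.1]
  rcases h.2 with h | h
  · have : ¬ c.Valid pos := h
    rw [c.extend_of_not_valid this]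
    ring
  · rw [c.sndRow_eq_zero h]
    ring

theorem free_eq_zero {t : c.Coord → S} {j : Fin 4} (h : ¬ B j) : c.free (c.extend t) j = 0 := by
  have hc : j ≠ c.c := by
    rintro rfl
    exact h c.plane_c
  have hv : ¬ c.Valid (form j) := fun h' => h h'.1
  rw [free, if_neg hc, c.extend_of_not_valid hv]

/-- Each summand is a coefficient times a minor, and the support condition kills one of the two. -/
theorem num_eq_zero {t : c.Coord → S} {s : Fin 4} (h : ∀ j, B j → ¬ G s j) :
    c.num (c.extend t) s = 0 := by
  rw [num, neg_eq_zero]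
  refine Finset.sum_eq_zero fun j _ => ?_
  by_cases hj : B j
  · rw [c.line_eq_zero (h j hj), mul_zero]
  · rw [c.free_eq_zero hj, zero_mul]

end Formulas

/-! ### The denominator and its nonvanishing. -/

section Polynomial

open MvPolynomial

/-- The universal parameters. -/
noncomputable def univ : FlagParam → MvPolynomial c.Coord ℂ := c.extend MvPolynomial.X

open Classical in
/-- The product of all the coordinates which are to be inverted. -/
noncomputable def denom : MvPolynomial c.Coord ℂ :=
  (∏ s, X s) * (∏ j with A j, c.point c.univ j) * (∏ x : Fin 4 × Fin 4 with G x.1 x.2, c.line c.univ x.1 x.2) *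
    ((if B c.d then c.num c.univ c.e else 1) * (if B c.e then c.num c.univ c.d else 1))

theorem X_dvd_denom (s : c.Coord) : X s ∣ c.denom :=
  Dvd.dvd.mul_right (Dvd.dvd.mul_right (Dvd.dvd.mul_right
    (Finset.dvd_prod_of_mem _ (Finset.mem_univ s)) _) _) _

theorem point_dvd_denom {j : Fin 4} (h : A j) : c.point c.univ j ∣ c.denom := by
  classical
  exact Dvd.dvd.mul_right (Dvd.dvd.mul_right (Dvd.dvd.mul_left
    (Finset.dvd_prod_of_mem _ (by simpa using h)) _) _) _

theorem line_dvd_denom {j k : Fin 4} (h : G j k) : c.line c.univ j k ∣ c.denom := by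
  classical
  exact Dvd.dvd.mul_right (Dvd.dvd.mul_left
    (Finset.dvd_prod_of_mem (fun x : Fin 4 × Fin 4 => c.line c.univ x.1 x.2)
      (a := (j, k)) (by simpa using h)) _) _

theorem num_e_dvd_denom (h : B c.d) : c.num c.univ c.e ∣ c.denom := by
  rw [denom, if_pos h]
  exact Dvd.dvd.mul_left (Dvd.intro _ rfl) _

theorem num_d_dvd_denom (h : B c.e) : c.num c.univ c.d ∣ c.denom := by
  rw [denom, if_pos h]
  exact Dvd.dvd.mul_left (Dvd.intro_left _ rfl) _

theorem eval_univ (t : c.Coord → ℂ) : (fun s => eval t (c.univ s)) = c.extend t := by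
  rw [univ, map_extend]
  simp

/-- A sample point of the parameter space. -/
def sample (g : Fin 4 → ℂ) : c.Coord → ℂ := fun s =>
  Sum.elim (Sum.elim (fun _ => 1) fun k : Fin 4 => ((k : ℕ) : ℂ) + 1) (Sum.elim g fun _ => 1) s.1

variable (g : Fin 4 → ℂ)

theorem fstRow_sample {j : Fin 4} (h : G j c.r) : c.fstRow (c.extend (c.sample g)) j = 1 := by
  rw [fstRow, if_pos h]
  split_ifs with hi
  · rfl
  · have : c.Valid (mag j) := ⟨hi, fun e => c.irrefl j (e ▸ h : G j j), Or.inl h⟩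
    rw [c.extend_of_valid this]
    rfl

theorem sndRow_sample_of_generic {j : Fin 4} (h : c.Generic j) :
    c.sndRow (c.extend (c.sample g)) j = (c.rep j : ℕ) + 1 := by
  have h1 : c.Valid (mag j) := ⟨c.ne_i_of_generic h, c.ne_r_of_generic h, Or.inl h.1⟩
  have h2 : c.Valid (slope (c.rep j)) := ⟨(rep_spec h).1, rep_rep h⟩
  rw [sndRow, if_pos h.2, if_neg (c.ne_r_of_generic h), if_pos h.1, c.extend_of_valid h1,
    c.extend_of_valid h2]
  simp [sample]

theorem sndRow_sample {j : Fin 4} (h : G c.i j) (h' : ¬ G j c.r) :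
    c.sndRow (c.extend (c.sample g)) j = 1 := by
  rw [sndRow, if_pos h, if_neg h']
  split_ifs with hr
  · rfl
  · have : c.Valid (mag j) := ⟨fun e => c.irrefl j (e ▸ h : G j j), hr, Or.inr h⟩
    rw [c.extend_of_valid this]
    rfl

/-- At the sample point the nonzero columns are `(1, 0)`, `(0, 1)` or `(1, k + 1)` with `k` the
representative; distinct classes give distinct, nonzero slopes. -/
theorem line_sample_ne_zero {j k : Fin 4} (h : G j k) :
    c.line (c.extend (c.sample g)) j k ≠ 0 := by
  have hpos : ∀ l : Fin 4, ((l : ℕ) : ℂ) + 1 ≠ 0 := fun l => Nat.cast_add_one_ne_zero _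
  have hi : ∃ s, G c.i s := ⟨_, c.line_i_r⟩
  have hr : ∃ s, G c.r s := ⟨_, c.symm c.line_i_r⟩
  have hj := line_r_or_line_i (c := c) h
  have hk := line_r_or_line_i (c := c) (c.symm h)
  by_cases j1 : G j c.r <;> by_cases k1 : G k c.r
  · by_cases j2 : G c.i j <;> by_cases k2 : G c.i k
    · have hne : c.rep j ≠ c.rep k := fun e => not_line_of_rep_eq ⟨j1, j2⟩ ⟨k1, k2⟩ e h
      rw [line, c.fstRow_sample g j1, c.fstRow_sample g k1, c.sndRow_sample_of_generic g ⟨j1, j2⟩,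
        c.sndRow_sample_of_generic g ⟨k1, k2⟩]
      intro e
      have h5 : ((c.rep k : ℕ) : ℂ) = (c.rep j : ℕ) := by linear_combination e
      exact hne (Fin.ext (Nat.cast_injective h5).symm)
    · rw [line, c.fstRow_sample g j1, c.fstRow_sample g k1, c.sndRow_sample_of_generic g ⟨j1, j2⟩,
        c.sndRow_eq_zero k2]
      simpa using neg_ne_zero.mpr (hpos (c.rep j))
    · rw [line, c.fstRow_sample g j1, c.fstRow_sample g k1, c.sndRow_sample_of_generic g ⟨k1, k2⟩,
        c.sndRow_eq_zero j2]
      simpa using hpos _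
    · exact absurd h (c.trans hi (c.not_symm j2) k2)
  · rw [line, c.fstRow_sample g j1, c.fstRow_eq_zero k1, c.sndRow_sample g (hk.resolve_left k1) k1]
    simp
  · rw [line, c.fstRow_sample g k1, c.fstRow_eq_zero j1, c.sndRow_sample g (hj.resolve_left j1) j1]
    simp
  · exact absurd h (c.trans hr j1 (c.not_symm k1))

/-- All sample entries are nonnegative and the position is 1 when present, so no cancellation can
occur in the sum of the two rows. -/
theorem point_sample_ne_zero {j : Fin 4} (h : A j) : c.point (c.extend (c.sample g)) j ≠ 0 := by
  have hlam : A c.r → c.extend (c.sample g) pos = 1 := fun h => by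
    have : c.Valid pos := h
    rw [c.extend_of_valid this]
    rfl
  by_cases h1 : G j c.r
  · rw [point, c.fstRow_sample g h1]
    by_cases h2 : G c.i j
    · rw [c.sndRow_sample_of_generic g ⟨h1, h2⟩]
      by_cases hr : A c.r
      · rw [hlam hr, one_mul]
        exact_mod_cast (by omega : 1 + ((c.rep j : ℕ) + 1) ≠ 0)
      · have : ¬ c.Valid pos := hr
        rw [c.extend_of_not_valid this]
        simp
    · rw [c.sndRow_eq_zero h2]
      simp
  · obtain ⟨hr, h2⟩ := ((c.point_iff j).mp h).resolve_left h1
    rw [point, c.fstRow_eq_zero h1, c.sndRow_sample g h2 h1, hlam hr]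
    simp

/-- The free coefficients can be chosen so that a single summand survives: that of `c.c` if its
minor with `s` is nonzero, and otherwise that of some other `k`, the normalized term being killed by
its minor. -/
theorem exists_num_sample_ne_zero {s : Fin 4} (h : ∃ j, B j ∧ j ≠ c.d ∧ j ≠ c.e ∧ G s j) :
    ∃ g, c.num (c.extend (c.sample g)) s ≠ 0 := by
  by_cases hc : G s c.c
  · refine ⟨0, ?_⟩
    rw [num, neg_ne_zero, Finset.sum_eq_single c.c]
    · rw [free, if_pos rfl, one_mul]
      exact c.line_sample_ne_zero 0 hc
    · intro j _ hj
      rw [free, if_neg hj]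
      by_cases hv : c.Valid (form j)
      · rw [c.extend_of_valid hv]
        simp [sample]
      · rw [c.extend_of_not_valid hv, zero_mul]
    · simp [c.c_ne_d, c.c_ne_e]
  · obtain ⟨k, hk, hkd, hke, hsk⟩ := h
    have hkc : k ≠ c.c := fun e => hc (e ▸ hsk)
    refine ⟨Pi.single k 1, ?_⟩
    rw [num, neg_ne_zero, Finset.sum_eq_single k]
    · have hv : c.Valid (form k) := ⟨hk, hkc, hkd, hke⟩
      rw [free, if_neg hkc, c.extend_of_valid hv]
      simpa [sample] using c.line_sample_ne_zero (Pi.single k 1) hsk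
    · intro j _ hj
      by_cases hjc : j = c.c
      · rw [hjc, c.line_eq_zero hc, mul_zero]
      · rw [free, if_neg hjc]
        by_cases hv : c.Valid (form j)
        · rw [c.extend_of_valid hv]
          simp [sample, hj]
        · rw [c.extend_of_not_valid hv, zero_mul]
    · simp [hkd, hke]

/-- The polynomial ring is a domain, so each factor may be tested at its own point; no common sample
point is needed. -/
theorem denom_ne_zero : c.denom ≠ 0 := by
  classical
  have hne : ∀ (t : c.Coord → ℂ) (p : MvPolynomial c.Coord ℂ), eval t p ≠ 0 → p ≠ 0 := by
    rintro t p h rfl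
    exact h (map_zero _)
  refine mul_ne_zero (mul_ne_zero (mul_ne_zero ?_ ?_) ?_) (mul_ne_zero ?_ ?_)
  · exact Finset.prod_ne_zero_iff.mpr fun s _ => X_ne_zero s
  · refine Finset.prod_ne_zero_iff.mpr fun j hj => hne (c.sample 0) _ ?_
    rw [map_point, eval_univ]
    exact c.point_sample_ne_zero 0 (by simpa using hj)
  · refine Finset.prod_ne_zero_iff.mpr fun x hx => hne (c.sample 0) _ ?_
    rw [map_line, eval_univ]
    exact c.line_sample_ne_zero 0 (by simpa using hx)
  · split_ifs with h
    · obtain ⟨g, hg⟩ := c.exists_num_sample_ne_zero (c.exists_line_e h)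
      refine hne (c.sample g) _ ?_
      rwa [map_num, eval_univ]
    · exact one_ne_zero
  · split_ifs with h
    · obtain ⟨g, hg⟩ := c.exists_num_sample_ne_zero (c.exists_line_d h)
      refine hne (c.sample g) _ ?_
      rwa [map_num, eval_univ]
    · exact one_ne_zero

end Polynomial

end FlagChart

/-! ### From parameters to flags. -/

namespace FlagChart

open FlagParam

variable {A B : Fin 4 → Prop} {G : Fin 4 → Fin 4 → Prop} (c : FlagChart A B G)

section Rows

variable {S : Type*} [CommRing S] (t : FlagParam → S)

theorem fstRow_i : c.fstRow t c.i = 1 := by rw [fstRow, if_pos c.line_i_r, if_pos rfl]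

theorem sndRow_i : c.sndRow t c.i = 0 := if_neg (c.irrefl _)

theorem fstRow_r : c.fstRow t c.r = 0 := if_neg (c.irrefl _)

theorem sndRow_r : c.sndRow t c.r = 1 := by rw [sndRow, if_pos c.line_i_r, if_pos rfl]

theorem line_i (j : Fin 4) : c.line t c.i j = c.sndRow t j := by
  rw [line, fstRow_i, sndRow_i]
  ring

theorem line_r (j : Fin 4) : c.line t j c.r = c.fstRow t j := by
  rw [line, fstRow_r, sndRow_r]
  ring

theorem point_index_i : c.point t c.i = 1 := by
  rw [point, fstRow_i, sndRow_i]
  ring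

theorem point_index_r : c.point t c.r = t pos := by
  rw [point, fstRow_r, sndRow_r]
  ring

end Rows

section Points

open MvPolynomial

variable {t : c.Coord → ℂ}

/-- The coefficients of the plane. -/
noncomputable def plane (t : FlagParam → ℂ) (j : Fin 4) : ℂ :=
  if j = c.d then c.num t c.e / c.line t c.e c.d
  else if j = c.e then c.num t c.d / c.line t c.d c.e else c.free t j

theorem plane_of_ne (t : FlagParam → ℂ) {j : Fin 4} (hd : j ≠ c.d) (he : j ≠ c.e) :
    c.plane t j = c.free t j := by
  rw [plane, if_neg hd, if_neg he]

theorem d_ne_e : c.d ≠ c.e := fun e => c.irrefl c.d (e ▸ c.line_d_e)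

theorem ne_zero_of_dvd_denom (ht : eval t c.denom ≠ 0) {p : MvPolynomial c.Coord ℂ}
    (h : p ∣ c.denom) : eval t p ≠ 0 := fun h0 => by
  have := map_dvd (eval t) h
  rw [h0, zero_dvd_iff] at this
  exact ht this

theorem point_ne_zero_iff (ht : eval t c.denom ≠ 0) (j : Fin 4) :
    c.point (c.extend t) j ≠ 0 ↔ A j := by
  refine ⟨fun h => by_contra fun h' => h (c.point_eq_zero h'), fun h => ?_⟩
  have := c.ne_zero_of_dvd_denom ht (c.point_dvd_denom h)
  rwa [map_point, eval_univ] at this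

theorem line_ne_zero_iff (ht : eval t c.denom ≠ 0) (j k : Fin 4) :
    c.line (c.extend t) j k ≠ 0 ↔ G j k := by
  refine ⟨fun h => by_contra fun h' => h (c.line_eq_zero h'), fun h => ?_⟩
  have := c.ne_zero_of_dvd_denom ht (c.line_dvd_denom h)
  rwa [map_line, eval_univ] at this

theorem extend_ne_zero (ht : eval t c.denom ≠ 0) {s : FlagParam} (hs : c.Valid s) :
    c.extend t s ≠ 0 := by
  have := c.ne_zero_of_dvd_denom ht (c.X_dvd_denom ⟨s, hs⟩)
  rwa [eval_X, ← c.extend_of_valid (t := t) hs] at this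

theorem plane_ne_zero_iff (ht : eval t c.denom ≠ 0) (j : Fin 4) :
    c.plane (c.extend t) j ≠ 0 ↔ B j := by
  by_cases hd : j = c.d
  · subst hd
    have h1 := (c.line_ne_zero_iff ht _ _).mpr (c.symm c.line_d_e)
    rw [plane, if_pos rfl, div_ne_zero_iff, and_iff_left h1]
    refine ⟨fun h => by_contra fun h' => h (c.num_eq_zero (c.not_line_e h')), fun h => ?_⟩
    have := c.ne_zero_of_dvd_denom ht (c.num_e_dvd_denom h)
    rwa [map_num, eval_univ] at this
  by_cases he : j = c.e
  · subst he
    have h1 := (c.line_ne_zero_iff ht _ _).mpr c.line_d_e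
    rw [plane, if_neg hd, if_pos rfl, div_ne_zero_iff, and_iff_left h1]
    refine ⟨fun h => by_contra fun h' => h (c.num_eq_zero (c.not_line_d h')), fun h => ?_⟩
    have := c.ne_zero_of_dvd_denom ht (c.num_d_dvd_denom h)
    rwa [map_num, eval_univ] at this
  rw [c.plane_of_ne _ hd he]
  refine ⟨fun h => by_contra fun h' => h (c.free_eq_zero h'), fun h => ?_⟩
  rw [free]
  split_ifs with hc
  · exact one_ne_zero
  · exact c.extend_ne_zero ht (s := form j) ⟨h, hc, hd, he⟩

/-- Splitting off the two dependent coefficients. -/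
theorem sum_eq {S : Type*} [AddCommMonoid S] (f : Fin 4 → S) :
    ∑ j, f j = f c.d + f c.e + ∑ j with j ≠ c.d ∧ j ≠ c.e, f j := by
  classical
  rw [← Finset.add_sum_erase _ _ (Finset.mem_univ c.d),
    ← Finset.add_sum_erase _ _ (Finset.mem_erase.mpr ⟨c.d_ne_e.symm, Finset.mem_univ c.e⟩),
    ← add_assoc]
  congr 1
  refine Finset.sum_congr ?_ fun _ _ => rfl
  ext j
  simp [and_comm]

/-- The dependent coefficients are defined so as to solve the equations for `c.d` and `c.e`. These
span all the others, because the columns `c.d` and `c.e` are independent. -/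
theorem sum_plane_mul_line (ht : eval t c.denom ≠ 0) (s : Fin 4) :
    ∑ j, c.plane (c.extend t) j * c.line (c.extend t) s j = 0 := by
  set T := c.extend t
  have h1 : c.line T c.e c.d ≠ 0 := (c.line_ne_zero_iff ht _ _).mpr (c.symm c.line_d_e)
  have h2 : c.line T c.d c.e ≠ 0 := (c.line_ne_zero_iff ht _ _).mpr c.line_d_e
  have hsum : ∀ s, ∑ j with j ≠ c.d ∧ j ≠ c.e, c.plane T j * c.line T s j = -c.num T s := by
    intro s
    rw [num, neg_neg]
    refine Finset.sum_congr rfl fun j hj => ?_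
    have := (Finset.mem_filter.mp hj).2
    rw [c.plane_of_ne _ this.1 this.2]
  have hd : c.plane T c.d = c.num T c.e / c.line T c.e c.d := if_pos rfl
  have he : c.plane T c.e = c.num T c.d / c.line T c.d c.e := by
    rw [plane, if_neg c.d_ne_e.symm, if_pos rfl]
  have he0 : ∑ j, c.plane T j * c.line T c.e j = 0 := by
    rw [c.sum_eq, hsum, c.line_self, hd]
    field_simp
    ring
  have hd0 : ∑ j, c.plane T j * c.line T c.d j = 0 := by
    rw [c.sum_eq, hsum, c.line_self, he]
    field_simp
    ring
  -- The three-term Plücker relation writes equation `s` as a combination of the equations `c.e` and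
  -- `c.d`.
  have key : ∀ j, c.plane T j * c.line T s j * c.line T c.e c.d =
      c.line T s c.d * (c.plane T j * c.line T c.e j) -
        c.line T s c.e * (c.plane T j * c.line T c.d j) := by
    intro j
    simp only [line]
    ring
  have : (∑ j, c.plane T j * c.line T s j) * c.line T c.e c.d = 0 := by
    rw [Finset.sum_mul]
    simp only [key, Finset.sum_sub_distrib, ← Finset.mul_sum, hd0, he0]
    ring
  exact (mul_eq_zero.mp this).resolve_right h1

/-- The flag with given parameters. -/
theorem exists_flag (ht : eval t c.denom ≠ 0) :
    ∃ p ∈ flagCone (Set.univ : Set (Fin 4)) ![1, 2, 3],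
      (∀ j, pointCoord p j = c.point (c.extend t) j) ∧
      (∀ j k, lineCoord p j k = c.line (c.extend t) j k) ∧
      ∀ j, planeCoord p j = c.plane (c.extend t) j := by
  -- The point is the first row plus a multiple of the second, so the point and the second row still
  -- span the line with the same minors.
  have hline : ∀ j k, c.point (c.extend t) j * c.sndRow (c.extend t) k -
      c.point (c.extend t) k * c.sndRow (c.extend t) j = c.line (c.extend t) j k := fun j k => by
    simp only [point, line]
    ring
  obtain ⟨p, hp, h0, h1, h2⟩ := exists_mem_flagCone (a := c.point (c.extend t))
    (v := c.sndRow (c.extend t)) (b := c.plane (c.extend t)) (i := c.i) (r := c.r)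
    (by rw [hline]; exact (c.line_ne_zero_iff ht _ _).mpr c.line_i_r)
    (fun s => by simpa only [hline] using c.sum_plane_mul_line ht s)
    ⟨c.c, (c.plane_ne_zero_iff ht _).mpr c.plane_c⟩
  exact ⟨p, hp, h0, fun j k => (h1 j k).trans (hline j k), h2⟩

end Points

/-! ### From flags to parameters. -/

section Values

variable {S : Type*} [CommRing S] (a b inv : Fin 4 → S) (P : Fin 4 → Fin 4 → S)

open Classical in
/-- The parameters of a flag. -/
noncomputable def value : c.Coord → S := fun s =>
  Sum.elim (Sum.elim (fun j => if G j c.r then P j c.r else P c.i j) fun k => P c.i k * inv k)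
    (Sum.elim b fun _ => a c.r) s.1

theorem map_value {T : Type*} [CommRing T] (φ : S →+* T) (s : c.Coord) :
    φ (c.value a b inv P s) = c.value (fun j => φ (a j)) (fun j => φ (b j)) (fun j => φ (inv j))
      (fun j k => φ (P j k)) s := by
  obtain ⟨(j | k) | (j | u), hs⟩ := s
  · by_cases hj : G j c.r
    · exact (congrArg φ (if_pos hj)).trans (if_pos hj).symm
    · exact (congrArg φ (if_neg hj)).trans (if_neg hj).symm
  · exact map_mul φ _ _
  · rfl
  · rfl

/-- Normalized coordinates with the given supports. -/
structure IsNormalized : Prop where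
  rel : IncidenceRelations a P b
  point_eq_zero : ∀ j, ¬ A j → a j = 0
  line_eq_zero : ∀ j k, ¬ G j k → P j k = 0
  plane_eq_zero : ∀ j, ¬ B j → b j = 0
  swap : ∀ j k, P k j = -P j k
  point_i : a c.i = 1
  line_i_r : P c.i c.r = 1
  plane_c : b c.c = 1
  mul_inv : ∀ k, G k c.r → P k c.r * inv k = 1

variable {c a b inv P}

namespace IsNormalized

variable (h : c.IsNormalized a b inv P)
include h

/-- The three-term relation at `i, j, k, r` with `P i r = 1`: the line is spanned by the rows `P j
r` and `P i j`. -/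
theorem line_eq (j k : Fin 4) : P j k = P j c.r * P c.i k - P k c.r * P c.i j := by
  linear_combination h.rel.line c.i j k c.r - P j k * h.line_i_r

omit h in
theorem extend_mag {j : Fin 4} (hj : c.Valid (mag j)) (h1 : G j c.r) :
    c.extend (c.value a b inv P) (mag j) = P j c.r := by
  rw [c.extend_of_valid hj]
  exact if_pos h1

theorem fstRow_value (j : Fin 4) : c.fstRow (c.extend (c.value a b inv P)) j = P j c.r := by
  by_cases h1 : G j c.r
  · rw [fstRow, if_pos h1]
    split_ifs with hi
    · rw [hi, h.line_i_r]
    · exact extend_mag ⟨hi, fun e => c.irrefl j (e ▸ h1 : G j j), Or.inl h1⟩ h1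
  · rw [c.fstRow_eq_zero h1, h.line_eq_zero _ _ h1]

theorem sndRow_value (j : Fin 4) : c.sndRow (c.extend (c.value a b inv P)) j = P c.i j := by
  by_cases h2 : G c.i j
  swap
  · rw [c.sndRow_eq_zero h2, h.line_eq_zero _ _ h2]
  have hi : j ≠ c.i := fun e => c.irrefl j (e ▸ h2 : G j j)
  rw [sndRow, if_pos h2]
  split_ifs with hr h1
  · rw [hr, h.line_i_r]
  · have hg : c.Generic j := ⟨h1, h2⟩
    obtain ⟨hg', hne⟩ := rep_spec hg
    have hv : c.Valid (slope (c.rep j)) := ⟨hg', rep_rep hg⟩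
    rw [extend_mag ⟨hi, hr, Or.inl h1⟩ h1, c.extend_of_valid hv]
    change P j c.r * (P c.i (c.rep j) * inv (c.rep j)) = _
    -- The vanishing minor of `j` and its representative transfers the slope of the representative
    -- to column `j`.
    have e1 := h.line_eq_zero _ _ hne
    rw [h.line_eq] at e1
    linear_combination P c.i j * h.mul_inv _ hg'.1 - inv (c.rep j) * e1
  · have hv : c.Valid (mag j) := ⟨hi, hr, Or.inr h2⟩
    rw [c.extend_of_valid hv]
    exact if_neg h1

theorem line_value (j k : Fin 4) : c.line (c.extend (c.value a b inv P)) j k = P j k := by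
  rw [line, h.fstRow_value, h.fstRow_value, h.sndRow_value, h.sndRow_value, ← h.line_eq]

theorem extend_pos : c.extend (c.value a b inv P) pos = a c.r := by
  by_cases hv : c.Valid pos
  · rw [c.extend_of_valid hv]
    rfl
  · rw [c.extend_of_not_valid hv, h.point_eq_zero _ hv]

theorem point_value (j : Fin 4) : c.point (c.extend (c.value a b inv P)) j = a j := by
  rw [point, h.fstRow_value, h.sndRow_value, h.extend_pos]
  linear_combination h.rel.point_line c.i j c.r - P j c.r * h.point_i + a j * h.line_i_r

theorem free_value {j : Fin 4} (hd : j ≠ c.d) (he : j ≠ c.e) :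
    c.free (c.extend (c.value a b inv P)) j = b j := by
  rw [free]
  split_ifs with hc
  · rw [hc, h.plane_c]
  · by_cases hj : B j
    · have hv : c.Valid (form j) := ⟨hj, hc, hd, he⟩
      rw [c.extend_of_valid hv]
      rfl
    · have hv : ¬ c.Valid (form j) := fun h' => hj h'.1
      rw [c.extend_of_not_valid hv, h.plane_eq_zero _ hj]

/-- The equation of the plane at `s`, with the free terms moved to the other side. At `s = e` or `s
= d` only one dependent coefficient remains. -/
theorem num_value (s : Fin 4) :
    c.num (c.extend (c.value a b inv P)) s = b c.d * P s c.d + b c.e * P s c.e := by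
  have h1 := h.rel.line_plane s
  rw [c.sum_eq] at h1
  have h2 : ∑ j with j ≠ c.d ∧ j ≠ c.e, c.free (c.extend (c.value a b inv P)) j *
      c.line (c.extend (c.value a b inv P)) s j = ∑ j with j ≠ c.d ∧ j ≠ c.e, b j * P s j :=
    Finset.sum_congr rfl fun j hj => by
      have := (Finset.mem_filter.mp hj).2
      rw [h.free_value this.1 this.2, h.line_value]
  rw [num, h2]
  linear_combination -h1

theorem num_e_value : c.num (c.extend (c.value a b inv P)) c.e = b c.d * P c.e c.d := by
  rw [h.num_value, h.line_eq_zero _ _ (c.irrefl c.e), mul_zero, add_zero]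

theorem num_d_value : c.num (c.extend (c.value a b inv P)) c.d = b c.e * P c.d c.e := by
  rw [h.num_value, h.line_eq_zero _ _ (c.irrefl c.d), mul_zero, zero_add]

end IsNormalized

/-- The parameters of the flag with given parameters. -/
theorem value_line {t : c.Coord → S} {T : FlagParam → S} (hT : T = c.extend t)
    (ha : ∀ j, a j = c.point T j) (hP : ∀ j k, P j k = c.line T j k)
    (hb : ∀ j, j ≠ c.d → j ≠ c.e → b j = c.free T j)
    (hinv : ∀ k, G k c.r → P k c.r * inv k = 1) (s : c.Coord) :
    c.value a b inv P s = t s := by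
  obtain ⟨s, hs⟩ := s
  rw [← c.extend_of_valid (t := t) hs, ← hT]
  rcases s with (j | k) | (j | u)
  · obtain ⟨hi, hr, -⟩ := id hs
    by_cases h1 : G j c.r
    · refine (if_pos h1).trans ?_
      rw [hP, c.line_r, fstRow, if_pos h1, if_neg hi]
    · refine (if_neg h1).trans ?_
      have h2 : G c.i j := by
        obtain ⟨-, -, h⟩ := id hs
        exact h.resolve_left h1
      rw [hP, c.line_i, sndRow, if_pos h2, if_neg hr, if_neg h1]
  · obtain ⟨hg, hk⟩ := id hs
    change P c.i k * inv k = T (slope k)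
    have h1 := hinv k hg.1
    rw [hP, c.line_r, fstRow, if_pos hg.1, if_neg (c.ne_i_of_generic hg)] at h1
    rw [hP, c.line_i, sndRow, if_pos hg.2, if_neg (c.ne_r_of_generic hg), if_pos hg.1, hk]
    linear_combination T (slope k) * h1
  · obtain ⟨-, hc, hd, he⟩ := id hs
    change b j = _
    rw [hb j hd he, free, if_neg hc]
  · change a c.r = _
    rw [ha, c.point_index_r]

end Values

end FlagChart

/-! ### Fractions with denominator a power of a fixed element. -/

section Fractions

variable {k R S : Type*} [CommRing k] [CommRing R] [CommRing S] [Algebra k R] [Algebra k S]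

/-- The elements which are fractions of elements of `R` with denominator a power of `f`. -/
def fractionSubalgebra (φ : R →ₐ[k] S) (f : R) : Subalgebra k S where
  carrier := {r | ∃ (n : ℕ) (g : R), r * φ f ^ n = φ g}
  mul_mem' := by
    rintro x y ⟨n, g, h⟩ ⟨m, g', h'⟩
    refine ⟨n + m, g * g', ?_⟩
    rw [map_mul, ← h, ← h']
    ring
  add_mem' := by
    rintro x y ⟨n, g, h⟩ ⟨m, g', h'⟩
    refine ⟨n + m, g * f ^ m + g' * f ^ n, ?_⟩
    rw [map_add, map_mul, map_mul, ← h, ← h', map_pow, map_pow]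
    ring
  algebraMap_mem' x := ⟨0, algebraMap k R x, by simp⟩

theorem apply_mem_fractionSubalgebra (φ : R →ₐ[k] S) (f g : R) : φ g ∈ fractionSubalgebra φ f :=
  ⟨0, g, by simp⟩

theorem mem_fractionSubalgebra_of_mul_eq_one {φ : R →ₐ[k] S} {f g : R} (hg : g ∣ f) {r : S}
    (h : φ g * r = 1) : r ∈ fractionSubalgebra φ f := by
  obtain ⟨g', rfl⟩ := hg
  refine ⟨1, g', ?_⟩
  rw [pow_one, map_mul]
  linear_combination φ g' * h

end Fractions

/-! ### Existence of a chart for a flag matroid. -/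

section Matroids

/-- `{j}` is a basis of `Q 0`. -/
def PointBase (Q : Fin 3 → Matroid (Fin 4)) (j : Fin 4) : Prop := (Q 0).IsBase {j}

/-- `{j, k}` is a basis of `Q 1`. -/
def LineBase (Q : Fin 3 → Matroid (Fin 4)) (j k : Fin 4) : Prop := j ≠ k ∧ (Q 1).IsBase {j, k}

/-- `[4] ∖ {j}` is a basis of `Q 2`. -/
def PlaneBase (Q : Fin 3 → Matroid (Fin 4)) (j : Fin 4) : Prop := (Q 2).IsBase {j}ᶜ

variable {Q : Fin 3 → Matroid (Fin 4)}

theorem isBaseIndex_pointIndex {j : Fin 4} : IsBaseIndex Q (pointIndex j) ↔ PointBase Q j := by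
  have : (Subtype.val '' (((pointIndex j).2.1 : Finset Ground) : Set Ground) : Set (Fin 4)) = {j} := by
    simp [pointIndex]
  unfold IsBaseIndex
  rw [this]
  rfl

theorem isBaseIndex_lineIndex {j k : Fin 4} (h : j < k) :
    IsBaseIndex Q (lineIndex j k h) ↔ LineBase Q j k := by
  have : (Subtype.val '' (((lineIndex j k h).2.1 : Finset Ground) : Set Ground) : Set (Fin 4)) =
      {j, k} := by
    simp [lineIndex, Set.image_pair]
  unfold IsBaseIndex
  rw [this]
  exact (and_iff_right h.ne).symm

theorem isBaseIndex_planeIndex {j : Fin 4} : IsBaseIndex Q (planeIndex j) ↔ PlaneBase Q j := by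
  have : (Subtype.val '' (((planeIndex j).2.1 : Finset Ground) : Set Ground) : Set (Fin 4)) = {j}ᶜ := by
    ext x
    simp [planeIndex]
  unfold IsBaseIndex
  rw [this]
  rfl

theorem LineBase.symm {j k : Fin 4} (h : LineBase Q j k) : LineBase Q k j :=
  ⟨h.1.symm, by rw [Set.pair_comm]; exact h.2⟩

theorem LineBase.indep_singleton {j k : Fin 4} (h : LineBase Q j k) : (Q 1).Indep {j} :=
  h.2.indep.subset (by simp)

variable (hQ : IsFlagMatroid Set.univ ![1, 2, 3] Q)
include hQ

theorem encard_of_isBase {i : Fin 3} {X : Set (Fin 4)} (h : (Q i).IsBase X) :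
    X.encard = ((![1, 2, 3] : Fin 3 → ℕ) i : ℕ) := by
  rw [h.encard_eq_eRank, hQ.eRank_eq]

theorem exists_pointBase : ∃ j, PointBase Q j := by
  obtain ⟨X, hX⟩ := (Q 0).exists_isBase
  have h := encard_of_isBase hQ hX
  obtain ⟨j, rfl⟩ := Set.encard_eq_one.mp h
  exact ⟨j, hX⟩

/-- An element of a basis of `Q 1` and the other one. -/
theorem lineBase_of_isBase {X : Set (Fin 4)} (h : (Q 1).IsBase X) {j : Fin 4} (hj : j ∈ X) :
    ∃ k ∈ X, LineBase Q j k := by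
  obtain ⟨x, y, hxy, rfl⟩ := Set.encard_eq_two.mp (encard_of_isBase hQ h)
  rcases hj with rfl | rfl
  · exact ⟨y, by simp, hxy, h⟩
  · exact ⟨x, by simp, hxy.symm, by rwa [Set.pair_comm]⟩

theorem exists_lineBase_of_indep {j : Fin 4} (h : (Q 1).Indep {j}) : ∃ k, LineBase Q j k := by
  obtain ⟨X, hX, hjX⟩ := h.exists_isBase_superset
  obtain ⟨k, -, hk⟩ := lineBase_of_isBase hQ hX (hjX rfl)
  exact ⟨k, hk⟩

theorem lineBase_of_indep {j k : Fin 4} (hjk : j ≠ k) (h : (Q 1).Indep {j, k}) : LineBase Q j k := by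
  obtain ⟨X, hX, hjX⟩ := h.exists_isBase_superset
  refine ⟨hjk, ?_⟩
  have : ({j, k} : Set (Fin 4)) = X := by
    refine (Set.toFinite _).eq_of_subset_of_encard_le hjX ?_
    rw [encard_of_isBase hQ hX, Set.encard_pair hjk]
    rfl
  rwa [this]

theorem planeBase_of_isBase {X : Set (Fin 4)} (h : (Q 2).IsBase X) : ∃ j, X = {j}ᶜ ∧ PlaneBase Q j := by
  have h1 := encard_of_isBase hQ h
  have h2 := Set.encard_add_encard_compl X
  rw [h1, Set.encard_univ] at h2
  have h3 : Xᶜ.encard = 1 := by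
    have hfin := (Set.toFinite Xᶜ).cast_ncard_eq
    rw [← hfin] at h2 ⊢
    simp only [ENat.card_eq_coe_fintype_card, Fintype.card_fin] at h2
    have h4 : 3 + Xᶜ.ncard = 4 := by exact_mod_cast h2
    exact_mod_cast (by omega : Xᶜ.ncard = 1)
  obtain ⟨j, hj⟩ := Set.encard_eq_one.mp h3
  have hX : X = {j}ᶜ := by rw [← hj, compl_compl]
  exact ⟨j, hX, by rwa [PlaneBase, ← hX]⟩

theorem mem_ground (i : Fin 3) (j : Fin 4) : j ∈ (Q i).E := by
  rw [hQ.ground_eq]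
  trivial

theorem mem_closure_of_not_lineBase {j k : Fin 4} (h : (Q 1).Indep {k}) (hjk : j ≠ k)
    (h' : ¬ LineBase Q j k) : j ∈ (Q 1).closure {k} := by
  by_contra hj
  exact h' (lineBase_of_indep hQ hjk
    ((h.notMem_closure_iff_of_notMem (by simpa using hjk) (mem_ground hQ 1 j)).mp hj))

/-- If `{j, l}` were a basis, the nonloop `k` could be completed to a basis by `j` or by `l`. -/
theorem not_lineBase_trans {j k l : Fin 4} (hk : ∃ s, LineBase Q k s) (hjk : ¬ LineBase Q j k)
    (hkl : ¬ LineBase Q k l) : ¬ LineBase Q j l := by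
  intro h
  obtain ⟨s, hs⟩ := hk
  obtain ⟨X, hX, hkX, hXsub⟩ := hs.indep_singleton.exists_isBase_subset_union_isBase h.2
  obtain ⟨y, hy, hky⟩ := lineBase_of_isBase hQ hX (hkX rfl)
  rcases hXsub hy with rfl | rfl | rfl
  · exact hky.1 rfl
  · exact hjk hky.symm
  · exact hkl hky

theorem not_pointBase_iff {j : Fin 4} : ¬ PointBase Q j ↔ j ∈ (Q 0).closure ∅ := by
  rw [not_iff_comm, (Matroid.empty_indep _).notMem_closure_iff_of_notMem (by simp) (mem_ground hQ 0 j)]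
  refine ⟨fun h => ?_, fun h => by simpa using h.indep⟩
  obtain ⟨X, hX, hjX⟩ := h.exists_isBase_superset
  have : (insert j ∅ : Set (Fin 4)) = X := by
    refine (Set.toFinite _).eq_of_subset_of_encard_le hjX ?_
    rw [encard_of_isBase hQ hX]
    simp
  rw [PointBase]
  rw [← this] at hX
  simpa using hX

/-- The set of loops of `Q 0` is closed in `Q 1`. -/
theorem not_pointBase_of_mem_closure {X : Set (Fin 4)} {j : Fin 4} (hX : ∀ k ∈ X, ¬ PointBase Q k)
    (hj : j ∈ (Q 1).closure X) : ¬ PointBase Q j := by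
  rw [not_pointBase_iff hQ]
  have hflat := hQ.isFlat_of_le 0 1 (by decide) _ ((Q 0).isFlat_closure (X := ∅))
  have : X ⊆ (Q 0).closure ∅ := fun k hk => (not_pointBase_iff hQ).mp (hX k hk)
  have := (Q 1).closure_subset_closure this hj
  rwa [hflat.closure] at this

theorem PointBase.exists_lineBase {j : Fin 4} (h : PointBase Q j) : ∃ k, LineBase Q j k := by
  refine exists_lineBase_of_indep hQ ?_
  by_contra hj
  refine not_pointBase_of_mem_closure hQ (X := ∅) (by simp) ?_ h
  by_contra hj'
  rw [(Matroid.empty_indep _).notMem_closure_iff_of_notMem (by simp) (mem_ground hQ 1 j)] at hj'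
  exact hj (by simpa using hj')

/-- The loops of `Q 0` form a flat of `Q 1`, so with `r` this flat contains everything parallel to
`r`. -/
theorem PointBase.lineBase {j r : Fin 4} (h : PointBase Q j) (hr : ¬ PointBase Q r)
    (hr' : ∃ s, LineBase Q r s) : LineBase Q j r := by
  by_contra hjr
  obtain ⟨s, hs⟩ := hr'
  have hne : j ≠ r := by
    rintro rfl
    exact hr h
  exact not_pointBase_of_mem_closure hQ (X := {r}) (by simpa using hr)
    (mem_closure_of_not_lineBase hQ hs.indep_singleton hne hjr) h

/-- If `j` and `r` were both loops of `Q 0`, the flat of loops would contain the span of a basis of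
`Q 1`, contradicting that `Q 0` has rank 1. -/
theorem LineBase.pointBase {j r : Fin 4} (h : LineBase Q j r) (hr : ¬ PointBase Q r) :
    PointBase Q j := by
  by_contra hj
  obtain ⟨i, hi⟩ := exists_pointBase hQ
  refine not_pointBase_of_mem_closure hQ (X := {j, r}) ?_ ?_ hi
  · rintro k (rfl | rfl) <;> assumption
  · rw [h.2.closure_eq]
    exact mem_ground hQ 1 i

/-- The circuit of `Q 2` is a union of circuits of `Q 1`. -/
theorem PlaneBase.exists_lineBase {d s : Fin 4} (h : PlaneBase Q d) (hs : LineBase Q s d) :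
    ∃ j, PlaneBase Q j ∧ j ≠ d ∧ LineBase Q s j := by
  have hflat := hQ.isFlat_of_le 1 2 (by decide) _ ((Q 1).isFlat_closure (X := {s}))
  have hd : d ∉ (Q 1).closure {s} := by
    rw [hs.indep_singleton.notMem_closure_iff_of_notMem (by simpa using hs.1.symm) (mem_ground hQ 1 d)]
    exact hs.symm.2.indep
  have hJ : (Q 2).Indep ((Q 1).closure {s} \ {d}) := h.indep.subset fun x hx => hx.2
  have hdJ : d ∉ (Q 2).closure ((Q 1).closure {s} \ {d}) := fun h' => by
    have := (Q 2).closure_subset_closure Set.sdiff_subset h'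
    rw [hflat.closure] at this
    exact hd this
  -- The closure of `{s}` in `Q 1` is a flat of `Q 2` missing `d`, so it stays independent in `Q 2`
  -- after adding `d`. The element `j` omitted by a basis containing both is not parallel to `s`.
  rw [hJ.notMem_closure_iff_of_notMem (by simp) (mem_ground hQ 2 d)] at hdJ
  obtain ⟨X, hX, hsub⟩ := hdJ.exists_isBase_superset
  obtain ⟨j, rfl, hj⟩ := planeBase_of_isBase hQ hX
  have hjd : j ≠ d := fun e => hsub (Set.mem_insert _ _) e.symm
  refine ⟨j, hj, hjd, ?_⟩
  have hjs : j ∉ (Q 1).closure {s} := fun h' => hsub (Set.mem_insert_of_mem _ ⟨h', hjd⟩) rfl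
  have hne : j ≠ s := by
    rintro rfl
    exact hjs ((Q 1).mem_closure_self j (mem_ground hQ 1 j))
  by_contra h'
  exact hjs (mem_closure_of_not_lineBase hQ hs.indep_singleton hne fun h'' => h' h''.symm)

/-- If some nonloop `r` of `Q 1` is a loop of `Q 0`, the bases of `Q 0` are exactly the elements
forming a basis of `Q 1` with `r`. Otherwise they are all the nonloops of `Q 1`, and any basis
through `i` serves. -/
theorem exists_line_chart : ∃ i r, PointBase Q i ∧ LineBase Q i r ∧
    ∀ j, PointBase Q j ↔ LineBase Q j r ∨ (PointBase Q r ∧ LineBase Q i j) := by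
  obtain ⟨i, hi⟩ := exists_pointBase hQ
  by_cases h : ∃ r, ¬ PointBase Q r ∧ ∃ s, LineBase Q r s
  · obtain ⟨r, hr, hr'⟩ := h
    refine ⟨i, r, hi, hi.lineBase hQ hr hr', fun j => ?_⟩
    rw [or_iff_left fun h => hr h.1]
    exact ⟨fun h => h.lineBase hQ hr hr', fun h => h.pointBase hQ hr⟩
  · push Not at h
    have hA : ∀ {j k}, LineBase Q j k → PointBase Q j := fun {j k} hjk => by
      by_contra hj
      exact h j hj k hjk
    obtain ⟨r, hr⟩ := hi.exists_lineBase hQ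
    refine ⟨i, r, hi, hr, fun j => ⟨fun hj => ?_, ?_⟩⟩
    · by_contra! h'
      exact not_lineBase_trans hQ (hj.exists_lineBase hQ) (h'.2 (hA hr.symm)) h'.1 hr
    · rintro (h' | h')
      · exact hA h'
      · exact hA h'.2.symm

/-- The choice puts as much of `{d, e}` as possible in the support of the plane: two independent
elements; else one nonloop, to which no support element is then independent; else the support
consists of loops of `Q 1` and any basis works. -/
theorem exists_plane_chart : ∃ d e, LineBase Q d e ∧
    (¬ PlaneBase Q d → ∀ j, PlaneBase Q j → ¬ LineBase Q e j) ∧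
    (¬ PlaneBase Q e → ∀ j, PlaneBase Q j → ¬ LineBase Q d j) := by
  by_cases h : ∃ d e, PlaneBase Q d ∧ PlaneBase Q e ∧ LineBase Q d e
  · obtain ⟨d, e, hd, he, h⟩ := h
    exact ⟨d, e, h, fun h => absurd hd h, fun h => absurd he h⟩
  push Not at h
  by_cases h' : ∃ d e, PlaneBase Q d ∧ LineBase Q d e
  · obtain ⟨d, e, hd, h'⟩ := h'
    exact ⟨d, e, h', fun h => absurd hd h, fun _ j hj => h d j hd hj⟩
  push Not at h'
  obtain ⟨i, r, -, h1, -⟩ := exists_line_chart hQ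
  exact ⟨i, r, h1, fun _ j hj h2 => h' j r hj h2.symm, fun _ j hj h2 => h' j i hj h2.symm⟩

theorem nonempty_flagChart : Nonempty (FlagChart (PointBase Q) (PlaneBase Q) (LineBase Q)) := by
  obtain ⟨i, r, hi, hir, hA⟩ := exists_line_chart hQ
  obtain ⟨d, e, hde, hd, he⟩ := exists_plane_chart hQ
  have hd' : PlaneBase Q d → ∃ j, PlaneBase Q j ∧ j ≠ d ∧ j ≠ e ∧ LineBase Q e j := fun h => by
    obtain ⟨j, hj, hjd, hej⟩ := h.exists_lineBase hQ hde.symm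
    exact ⟨j, hj, hjd, hej.1.symm, hej⟩
  have he' : PlaneBase Q e → ∃ j, PlaneBase Q j ∧ j ≠ d ∧ j ≠ e ∧ LineBase Q d j := fun h => by
    obtain ⟨j, hj, hje, hdj⟩ := h.exists_lineBase hQ hde
    exact ⟨j, hj, hdj.1.symm, hje, hdj⟩
  have hc : ∃ c, PlaneBase Q c ∧ c ≠ d ∧ c ≠ e := by
    by_cases h1 : PlaneBase Q d
    · obtain ⟨j, hj, h2, h3, -⟩ := hd' h1
      exact ⟨j, hj, h2, h3⟩
    by_cases h2 : PlaneBase Q e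
    · obtain ⟨j, hj, h3, h4, -⟩ := he' h2
      exact ⟨j, hj, h3, h4⟩
    obtain ⟨X, hX⟩ := (Q 2).exists_isBase
    obtain ⟨c, -, hc⟩ := planeBase_of_isBase hQ hX
    exact ⟨c, hc, fun e => h1 (e ▸ hc), fun e => h2 (e ▸ hc)⟩
  obtain ⟨c, hc, hcd, hce⟩ := hc
  exact ⟨{
    symm := LineBase.symm
    irrefl := fun j h => h.1 rfl
    trans := not_lineBase_trans hQ
    i := i, r := r, d := d, e := e, c := c
    point_i := hi
    line_i_r := hir
    point_iff := hA
    line_d_e := hde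
    plane_c := hc
    c_ne_d := hcd
    c_ne_e := hce
    not_line_e := hd
    not_line_d := he
    exists_line_e := hd'
    exists_line_d := he' }⟩

end Matroids

/-! ### Every coordinate is a fraction in the parameters. -/

namespace FlagChart

open FlagParam MvPolynomial

variable {A B : Fin 4 → Prop} {G : Fin 4 → Fin 4 → Prop} {c : FlagChart A B G}
variable {S : Type*} [CommRing S] [Algebra ℂ S] {a b inv : Fin 4 → S} {P : Fin 4 → Fin 4 → S}

theorem aeval_univ (u : c.Coord → S) : (fun s => aeval u (c.univ s)) = c.extend u := by
  have := c.map_extend (aeval (R := ℂ) u).toRingHom MvPolynomial.X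
  refine this.trans ?_
  congr 1
  ext s
  exact aeval_X u s

theorem aeval_point (u : c.Coord → S) (j : Fin 4) :
    aeval u (c.point c.univ j) = c.point (c.extend u) j := by
  rw [← aeval_univ]
  exact c.map_point (aeval (R := ℂ) u).toRingHom j

theorem aeval_line (u : c.Coord → S) (j k : Fin 4) :
    aeval u (c.line c.univ j k) = c.line (c.extend u) j k := by
  rw [← aeval_univ]
  exact c.map_line (aeval (R := ℂ) u).toRingHom j k

theorem aeval_num (u : c.Coord → S) (j : Fin 4) :
    aeval u (c.num c.univ j) = c.num (c.extend u) j := by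
  rw [← aeval_univ]
  exact c.map_num (aeval (R := ℂ) u).toRingHom j

namespace IsNormalized

variable (h : c.IsNormalized a b inv P)
include h

/-- Each factor of the denominator evaluates to a coordinate of a basis, to a slope, or to a plane
coefficient times a line coordinate, all of which are units. -/
theorem isUnit_aeval_denom (hA : ∀ j, A j → IsUnit (a j)) (hG : ∀ j k, G j k → IsUnit (P j k))
    (hB : ∀ j, B j → IsUnit (b j)) : IsUnit (aeval (c.value a b inv P) c.denom) := by
  classical
  rw [denom]
  simp only [map_mul, map_prod, aeval_X, aeval_point, aeval_line, h.point_value, h.line_value]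
  refine IsUnit.mul (IsUnit.mul (IsUnit.mul ?_ ?_) ?_) (IsUnit.mul ?_ ?_)
  · refine IsUnit.prod_univ_iff.mpr ?_
    rintro ⟨(j | k) | (j | u), hs⟩
    · obtain ⟨-, -, h'⟩ := hs
      change IsUnit (if G j c.r then P j c.r else P c.i j)
      split_ifs with h1
      · exact hG _ _ h1
      · exact hG _ _ (h'.resolve_left h1)
    · obtain ⟨⟨h1, h2⟩, -⟩ := hs
      exact (hG _ _ h2).mul (IsUnit.of_mul_eq_one_right _ (h.mul_inv _ h1))
    · exact hB _ hs.1
    · exact hA _ hs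
  · exact IsUnit.prod_iff.mpr fun j hj => hA _ (by simpa using hj)
  · exact IsUnit.prod_iff.mpr fun x hx => hG _ _ (by simpa using hx)
  · split_ifs with h'
    · rw [aeval_num, h.num_e_value]
      exact (hB _ h').mul (hG _ _ (c.symm c.line_d_e))
    · simp
  · split_ifs with h'
    · rw [aeval_num, h.num_d_value]
      exact (hB _ h').mul (hG _ _ c.line_d_e)
    · simp

/-- The ring of fractions generated by the parameters. -/
noncomputable abbrev fractions (_ : c.IsNormalized a b inv P) : Subalgebra ℂ S :=
  fractionSubalgebra (aeval (R := ℂ) (c.value a b inv P)) c.denom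

theorem point_mem (j : Fin 4) : a j ∈ h.fractions := by
  rw [← h.point_value j, ← aeval_point]
  exact apply_mem_fractionSubalgebra _ _ _

theorem line_mem (j k : Fin 4) : P j k ∈ h.fractions := by
  rw [← h.line_value j k, ← aeval_line]
  exact apply_mem_fractionSubalgebra _ _ _

theorem point_inv_mem {j : Fin 4} (hj : A j) {t : S} (ht : a j * t = 1) : t ∈ h.fractions := by
  refine mem_fractionSubalgebra_of_mul_eq_one (c.point_dvd_denom hj) ?_
  rwa [aeval_point, h.point_value]

theorem line_inv_mem {j k : Fin 4} (hj : G j k) {t : S} (ht : P j k * t = 1) :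
    t ∈ h.fractions := by
  refine mem_fractionSubalgebra_of_mul_eq_one (c.line_dvd_denom hj) ?_
  rwa [aeval_line, h.line_value]

/-- A dependent plane coefficient is its numerator divided by a line coordinate; both divide the
denominator, so the quotient and its inverse are fractions. -/
theorem mem_and_inv_mem_of_num {j s x : Fin 4} (hxs : G x s) (hP : IsUnit (P x s))
    (hnum : c.num (c.extend (c.value a b inv P)) x = b j * P x s)
    (hdvd : c.num c.univ x ∣ c.denom) {t : S} (ht : b j * t = 1) :
    b j ∈ h.fractions ∧ t ∈ h.fractions := by
  obtain ⟨y, hy⟩ := hP.exists_right_inv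
  have hnum' : aeval (c.value a b inv P) (c.num c.univ x) = b j * P x s := by
    rw [aeval_num, hnum]
  constructor
  · have : b j = aeval (c.value a b inv P) (c.num c.univ x) * y := by
      rw [hnum']
      linear_combination -b j * hy
    rw [this]
    exact mul_mem (apply_mem_fractionSubalgebra _ _ _) (h.line_inv_mem hxs hy)
  · have h1 : t * y ∈ h.fractions := by
      refine mem_fractionSubalgebra_of_mul_eq_one hdvd ?_
      rw [hnum']
      linear_combination P x s * y * ht + hy
    have : t = t * y * P x s := by linear_combination -t * hy
    rw [this]
    exact mul_mem h1 (h.line_mem _ _)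

theorem plane_mem_and_inv_mem (hG : ∀ j k, G j k → IsUnit (P j k)) {j : Fin 4} (hj : B j) {t : S}
    (ht : b j * t = 1) : b j ∈ h.fractions ∧ t ∈ h.fractions := by
  by_cases hd : j = c.d
  · subst hd
    have h1 := c.symm c.line_d_e
    exact h.mem_and_inv_mem_of_num h1 (hG _ _ h1) h.num_e_value (c.num_e_dvd_denom hj) ht
  by_cases he : j = c.e
  · subst he
    exact h.mem_and_inv_mem_of_num c.line_d_e (hG _ _ c.line_d_e) h.num_d_value
      (c.num_d_dvd_denom hj) ht
  by_cases hc : j = c.c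
  · subst hc
    rw [h.plane_c, one_mul] at ht
    rw [h.plane_c, ht]
    exact ⟨one_mem _, one_mem _⟩
  · have hv : c.Valid (form j) := ⟨hj, hc, hd, he⟩
    have h1 : aeval (R := ℂ) (c.value a b inv P) (X ⟨form j, hv⟩) = b j := aeval_X _ _
    refine ⟨?_, ?_⟩
    · rw [← h1]
      exact apply_mem_fractionSubalgebra _ _ _
    refine mem_fractionSubalgebra_of_mul_eq_one (c.X_dvd_denom ⟨form j, hv⟩) ?_
    rwa [h1]

end IsNormalized

end FlagChart

/-! ### Assembling the theorem. -/

section Main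

variable {Q : Fin 3 → Matroid (Fin 4)}

/-- The sign does not depend on the ring, so one normalizer serves both the stratum ring and its
complex points. -/
theorem exists_lineIndex {j k : Fin 4} (h : LineBase Q j k) :
    ∃ (y : FlagIndex) (σ : ℂ), y.1 = 1 ∧ IsBaseIndex Q y ∧ σ ≠ 0 ∧
      ∀ {S : Type} [CommRing S] [Algebra ℂ S] (π : FlagIndex → S), lineCoord π j k = σ • π y := by
  rcases lt_or_gt_of_ne h.1 with hlt | hlt
  · exact ⟨lineIndex j k hlt, 1, rfl, (isBaseIndex_lineIndex hlt).mpr h, one_ne_zero,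
      fun π => by rw [lineCoord_of_lt π hlt, one_smul]⟩
  · exact ⟨lineIndex k j hlt, -1, rfl, (isBaseIndex_lineIndex hlt).mpr h.symm,
      neg_ne_zero.mpr one_ne_zero,
      fun π => by rw [lineCoord_swap, lineCoord_of_lt π hlt, neg_smul, one_smul]⟩

theorem planeCoord_eq_smul {S : Type} [CommRing S] [Algebra ℂ S] (π : FlagIndex → S) (j : Fin 4) :
    planeCoord π j = ((-1) ^ (j : ℕ) : ℂ) • π (planeIndex j) := by
  rw [planeCoord, Algebra.smul_def, map_pow, map_neg, map_one]

/-- A normalizer adapted to a point, a line and a plane coordinate. -/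
theorem exists_normalizer {i r c : Fin 4} (hi : PointBase Q i) (hir : LineBase Q i r)
    (hc : PlaneBase Q c) : ∃ n : Normalizer (Set.univ : Set (Fin 4)) ![1, 2, 3] Q,
      ∀ {S : Type} [CommRing S] [Algebra ℂ S] (π : FlagIndex → S),
        pointCoord π i = n.scalar 0 • π (n.index 0) ∧
        lineCoord π i r = n.scalar 1 • π (n.index 1) ∧
        planeCoord π c = n.scalar 2 • π (n.index 2) := by
  obtain ⟨y, σ, hy1, hy, hσ, h⟩ := exists_lineIndex hir
  refine ⟨⟨![pointIndex i, y, planeIndex c], ?_, ?_, ![1, σ, (-1) ^ (c : ℕ)], ?_⟩, ?_⟩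
  · intro k
    fin_cases k
    · rfl
    · exact hy1
    · rfl
  · intro k
    fin_cases k
    · exact isBaseIndex_pointIndex.mpr hi
    · exact hy
    · exact isBaseIndex_planeIndex.mpr hc
  · intro k
    fin_cases k <;> simp [hσ]
  · intro S _ _ π
    exact ⟨(one_smul ℂ _).symm, h π, planeCoord_eq_smul π c⟩

variable {S : Type} [CommRing S]

theorem lineCoord_eq_zero {π : FlagIndex → S} (hπ : ∀ x, ¬ IsBaseIndex Q x → π x = 0) {j k : Fin 4}
    (h : ¬ LineBase Q j k) : lineCoord π j k = 0 := by
  rcases lt_trichotomy j k with hlt | rfl | hlt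
  · rw [lineCoord_of_lt _ hlt, hπ _ (by rwa [isBaseIndex_lineIndex])]
  · exact lineCoord_self _ _
  · rw [lineCoord_swap, lineCoord_of_lt _ hlt,
      hπ _ (by rw [isBaseIndex_lineIndex]; exact fun h' => h h'.symm), neg_zero]

theorem isUnit_lineCoord {π : FlagIndex → S} (hπ : ∀ x, IsBaseIndex Q x → IsUnit (π x))
    {j k : Fin 4} (h : LineBase Q j k) : IsUnit (lineCoord π j k) := by
  rcases lt_or_gt_of_ne h.1 with hlt | hlt
  · rw [lineCoord_of_lt _ hlt]
    exact hπ _ (by rwa [isBaseIndex_lineIndex])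
  · rw [lineCoord_swap, lineCoord_of_lt _ hlt]
    exact (hπ _ (by rw [isBaseIndex_lineIndex]; exact h.symm)).neg

theorem isUnit_planeCoord_iff {π : FlagIndex → S} {j : Fin 4} :
    IsUnit (planeCoord π j) ↔ IsUnit (π (planeIndex j)) := by
  rw [planeCoord, IsUnit.mul_iff, and_iff_right (isUnit_one.neg.pow _)]

theorem mem_of_planeCoord_mem [Algebra ℂ S] (T : Subalgebra ℂ S) {π : FlagIndex → S} {j : Fin 4}
    {t : S} (h : planeCoord π j ∈ T) (ht : t ∈ T) (hmul : planeCoord π j * t = 1) :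
    π (planeIndex j) ∈ T ∧ ∃ t ∈ T, π (planeIndex j) * t = 1 := by
  have hsgn : ((-1) ^ (j : ℕ) : S) ∈ T := pow_mem (neg_mem (one_mem _)) _
  have hsq : ((-1) ^ (j : ℕ) : S) * (-1) ^ (j : ℕ) = 1 := by
    rw [← mul_pow]
    simp
  have hco : π (planeIndex j) = (-1) ^ (j : ℕ) * planeCoord π j := by
    rw [planeCoord, ← mul_assoc, hsq, one_mul]
  rw [hco]
  refine ⟨mul_mem hsgn h, (-1) ^ (j : ℕ) * t, mul_mem hsgn ht, ?_⟩
  rw [mul_mul_mul_comm, hsq, hmul, one_mul]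

section Normalized

variable [Algebra ℂ S] {c : FlagChart (PointBase Q) (PlaneBase Q) (LineBase Q)} {π : FlagIndex → S}
  {inv : Fin 4 → S}

omit [Algebra ℂ S] in
theorem FlagChart.IsNormalized.of_coord
    (hrel : IncidenceRelations (pointCoord π) (lineCoord π) (planeCoord π))
    (hπ : ∀ x, ¬ IsBaseIndex Q x → π x = 0) (h0 : pointCoord π c.i = 1)
    (h1 : lineCoord π c.i c.r = 1) (h2 : planeCoord π c.c = 1)
    (hinv : ∀ k, LineBase Q k c.r → lineCoord π k c.r * inv k = 1) :
    c.IsNormalized (pointCoord π) (planeCoord π) inv (lineCoord π) where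
  rel := hrel
  point_eq_zero j hj := hπ _ (by rwa [isBaseIndex_pointIndex])
  line_eq_zero j k hjk := lineCoord_eq_zero hπ hjk
  plane_eq_zero j hj := by rw [planeCoord, hπ _ (by rwa [isBaseIndex_planeIndex]), mul_zero]
  swap := lineCoord_swap _
  point_i := h0
  line_i_r := h1
  plane_c := h2
  mul_inv := hinv

theorem FlagChart.IsNormalized.mem_of_isBaseIndex
    (h : c.IsNormalized (pointCoord π) (planeCoord π) inv (lineCoord π))
    (hπ : ∀ x, IsBaseIndex Q x → IsUnit (π x)) (x : FlagIndex) :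
    IsBaseIndex Q x → π x ∈ h.fractions ∧ ∃ t ∈ h.fractions, π x * t = 1 := by
  refine flagIndex_cases (motive := fun x => IsBaseIndex Q x → π x ∈ h.fractions ∧
      ∃ t ∈ h.fractions, π x * t = 1) (fun j hj => ?_) (fun j k hlt hj => ?_) (fun j hj => ?_) x
  · obtain ⟨t, ht⟩ := (hπ _ hj).exists_right_inv
    rw [isBaseIndex_pointIndex] at hj
    exact ⟨h.point_mem j, t, h.point_inv_mem hj ht, ht⟩
  · obtain ⟨t, ht⟩ := (hπ _ hj).exists_right_inv
    rw [isBaseIndex_lineIndex] at hj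
    rw [← lineCoord_of_lt π hlt] at ht ⊢
    exact ⟨h.line_mem j k, t, h.line_inv_mem hj ht, ht⟩
  · obtain ⟨t, ht⟩ := (isUnit_planeCoord_iff.mpr (hπ _ hj)).exists_right_inv
    rw [isBaseIndex_planeIndex] at hj
    obtain ⟨h1, h2⟩ := h.plane_mem_and_inv_mem (fun j k => isUnit_lineCoord hπ) hj ht
    exact mem_of_planeCoord_mem _ h1 h2 ht

end Normalized

variable (c : FlagChart (PointBase Q) (PlaneBase Q) (LineBase Q))
  (n : Normalizer (Set.univ : Set (Fin 4)) ![1, 2, 3] Q)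

/-- The points of the chart are points of the stratum. -/
theorem FlagChart.exists_algHom
    (hn : ∀ {S : Type} [CommRing S] [Algebra ℂ S] (π : FlagIndex → S),
        pointCoord π c.i = n.scalar 0 • π (n.index 0) ∧
        lineCoord π c.i c.r = n.scalar 1 • π (n.index 1) ∧
        planeCoord π c.c = n.scalar 2 • π (n.index 2))
    {t : c.Coord → ℂ} (ht : MvPolynomial.eval t c.denom ≠ 0) :
    ∃ ev : stratumRing Set.univ ![1, 2, 3] Q →ₐ[ℂ] ℂ,
      (∀ j, ev (pointCoord n.coord j) = c.point (c.extend t) j) ∧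
      (∀ j k, ev (lineCoord n.coord j k) = c.line (c.extend t) j k) ∧
      ∀ j, ev (planeCoord n.coord j) = c.plane (c.extend t) j := by
  obtain ⟨p, hp, h0, h1, h2⟩ := c.exists_flag ht
  have hsupp : ∀ x, p x ≠ 0 ↔ IsBaseIndex Q x := by
    refine flagIndex_cases (fun j => ?_) (fun j k hlt => ?_) fun j => ?_
    · rw [isBaseIndex_pointIndex, ← c.point_ne_zero_iff ht, ← h0]
      rfl
    · rw [isBaseIndex_lineIndex, ← c.line_ne_zero_iff ht, ← h1, lineCoord_of_lt]
    · rw [isBaseIndex_planeIndex, ← c.plane_ne_zero_iff ht, ← h2, ← isUnit_iff_ne_zero,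
        ← isUnit_iff_ne_zero, isUnit_planeCoord_iff]
  obtain ⟨ev, hev⟩ := exists_algHom_of_mem_flagCone hp hsupp
  -- The chart flag already has the normalized coordinates equal to 1, so normalizing does not
  -- change its values.
  have hunit : ∀ i, ev (n.unit i) = 1 := by
    intro i
    obtain ⟨n0, n1, n2⟩ := hn p
    rw [n.coe_unit, map_smul, hev]
    fin_cases i
    · exact n0.symm.trans ((h0 _).trans (c.point_index_i _))
    · exact n1.symm.trans ((h1 _ _).trans ((c.line_r _ _).trans (c.fstRow_i _)))
    · refine n2.symm.trans ((h2 _).trans ?_)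
      rw [c.plane_of_ne _ c.c_ne_d c.c_ne_e]
      exact if_pos rfl
  have hinv : ∀ i, ev ((n.unit i)⁻¹ : (LaurentRing Set.univ ![1, 2, 3] Q)ˣ) = 1 := by
    intro i
    have := congrArg ev (n.unit i).mul_inv
    rwa [map_mul, hunit, one_mul, map_one] at this
  let ev' : stratumRing Set.univ ![1, 2, 3] Q →ₐ[ℂ] ℂ := ev.comp (stratumRing _ _ Q).val
  have hev' : (fun x => ev' (n.coord x)) = p := by
    ext x
    change ev (laurentCoord Q x * _) = _
    rw [map_mul, hinv, hev, mul_one]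
  refine ⟨ev', fun j => ?_, fun j k => ?_, fun j => ?_⟩
  · rw [← h0, ← hev']
    rfl
  · rw [← h1, ← hev']
    exact map_lineCoord ev'.toRingHom _ _ _
  · rw [← h2, ← hev']
    exact map_planeCoord ev'.toRingHom _ _

end Main

theorem mainTheorem5 (Q : Fin 3 → Matroid (Fin 4))
    (hQ : IsFlagMatroid Set.univ ![1, 2, 3] Q) :
    AlgebraicGeometry.Smooth (flagStratumToSpec Set.univ ![1, 2, 3] Q) ∧
    IrreducibleSpace (flagStratum Set.univ ![1, 2, 3] Q) ∧
    (IsProductOfSmallerStrata Set.univ ![1, 2, 3] Q ∨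
      IsOpenInTorus Set.univ ![1, 2, 3] Q) := by
  obtain ⟨c⟩ := nonempty_flagChart hQ
  obtain ⟨n, hn⟩ := exists_normalizer c.point_i c.line_i_r c.plane_c
  have hG : ∀ j k, LineBase Q j k → IsUnit (lineCoord n.coord j k) :=
    fun j k => isUnit_lineCoord fun x => n.isUnit_coord
  have hA : ∀ j, PointBase Q j → IsUnit (pointCoord n.coord j) :=
    fun j hj => n.isUnit_coord (isBaseIndex_pointIndex.mpr hj)
  have hB : ∀ j, PlaneBase Q j → IsUnit (planeCoord n.coord j) :=
    fun j hj => isUnit_planeCoord_iff.mpr (n.isUnit_coord (isBaseIndex_planeIndex.mpr hj))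
  have hinv : ∀ k, ∃ v, LineBase Q k c.r → lineCoord n.coord k c.r * v = 1 := fun k => by
    by_cases hk : LineBase Q k c.r
    · obtain ⟨v, hv⟩ := (hG _ _ hk).exists_right_inv
      exact ⟨v, fun _ => hv⟩
    · exact ⟨0, fun h => absurd h hk⟩
  choose inv hinv using hinv
  obtain ⟨n0, n1, n2⟩ := hn n.coord
  have h := FlagChart.IsNormalized.of_coord (incidenceRelations_coord n) (fun _ => n.coord_of_not)
    (n0.trans (n.scalar_smul_coord_index 0)) (n1.trans (n.scalar_smul_coord_index 1))
    (n2.trans (n.scalar_smul_coord_index 2)) hinv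
  have hunit := h.isUnit_aeval_denom hA hG hB
  -- Algebraic independence: the flag built from `t` gives a point of the stratum whose parameters
  -- are `t` again.
  have hinj := aeval_injective_of_points
    (u := c.value (pointCoord n.coord) (planeCoord n.coord) inv (lineCoord n.coord)) c.denom_ne_zero fun t ht => by
    obtain ⟨ev, e0, e1, e2⟩ := c.exists_algHom n hn ht
    refine ⟨ev, fun s => Eq.trans ?_ (FlagChart.value_line (a := fun j => ev (pointCoord n.coord j))
      (b := fun j => ev (planeCoord n.coord j)) (inv := fun j => ev (inv j))
      (P := fun j k => ev (lineCoord n.coord j k)) (t := t) rfl e0 e1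
      (fun j hd he => (e2 j).trans (c.plane_of_ne _ hd he))
      (fun k hk => by rw [← map_mul, hinv k hk, map_one]) s)⟩
    exact c.map_value _ _ _ _ ev.toRingHom s
  have htop : h.fractions = ⊤ :=
    n.eq_top_of_coord_mem _ (h.mem_of_isBaseIndex fun _ => n.isUnit_coord)
  have hsurj : ∀ x, x ∈ h.fractions := fun x => htop ▸ Algebra.mem_top
  -- The torus alternative is proved for every flag matroid, so product decompositions play no role.
  refine ⟨smooth_of_aeval hunit hinj hsurj, ?_, Or.inr ?_⟩
  · have := isDomain_of_aeval c.denom_ne_zero hunit hinj hsurj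
    exact PrimeSpectrum.irreducibleSpace
  · exact exists_isOpenImmersion_algTorus c.X_dvd_denom hunit hinj hsurj
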